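/- Identify $\mathfrak{sl}_2(\mathbb C)$ with $\mathbb C^3\cong\mathbb R^6$ by $$(z_1,z_2,z_3)\mapsto A=\begin{pmatrix} iz_1 & -z_2+iz_3\\ z_2+iz_3 & -iz_1\end{pmatrix},\qquad z_j=x_j+iy_j,$$ write $\partial_{z_j}=\tfrac12(\partial_{x_j}-i\,\partial_{y_j})$, and let $$\pi=4\,\mathrm{Re}\big(z_1\,\partial_{z_2}\wedge\partial_{z_3}+z_2\,\partial_{z_3}\wedge\partial_{z_1}+z_3\,\partial_{z_1}\wedge\partial_{z_2}\big),$$ which is the linear Poisson structure of the real Lie algebra $\mathfrak{sl}_2(\mathbb C)$ (identified with its dual by the trace form). Let $f_1,f_2$ be the real and imaginary parts of $\det A=z_1^2+z_2^2+z_3^2$. The formal Poisson cohomology $H^\bullet_F(\mathfrak{sl}_2(\mathbb C),\pi)$ at $0$ is the cohomology of the complex of multivector fields with coefficients in $\mathbb R[[x_1,x_2,x_3,y_1,y_2,y_3]]$, with differential $d_\pi=[\pi,\cdot]$ (Schouten–Nijenhuis bracket). Let $C_{\mathcal R}$ and $C_{\mathcal I}$ be $\tfrac43$ of the real and of the imaginary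 part of the Cartan three-form $3\,\partial_{z_1}\wedge\partial_{z_2}\wedge\partial_{z_3}$. **Proposition 1.4.** One has $$H^k_F(\mathfrak{sl}_2(\mathbb C),\pi)=\begin{cases}\mathbb R[[f_1,f_2]] & k=0,\\ \mathbb R[[f_1,f_2]]\cdot C_{\mathcal R}\oplus\mathbb R[[f_1,f_2]]\cdot C_{\mathcal I} & k=3,\\ \mathbb R[[f_1,f_2]]\cdot C_{\mathcal R}\wedge C_{\mathcal I} & k=6,\\ 0 & \text{otherwise.}\end{cases}$$ More precisely, as $g,h$ range over the formal power series in two variables, the maps $g\mapsto[g(f_1,f_2)]$, $(g,h)\mapsto[g(f_1,f_2)\,C_{\mathcal R}+h(f_1,f_2)\,C_{\mathcal I}]$ and $g\mapsto[g(f_1,f_2)\,C_{\mathcal R}\wedge C_{\mathcal I}]$ are well-defined bijections onto $H^0_F$, $H^3_F$ and $H^6_F$ respectively. Explicitly (with wedge signs omitted), $$C_{\mathcal R}=\tfrac12\big(\partial_{x_1}\partial_{x_2}\partial_{x_3}-\partial_{y_1}\partial_{y_2}\partial_{x_3}-\partial_{x_1}\partial_{y_2}\partial_{y_3}-\partial_{y_1}\partial_{x_2}\partial_{y_3}\big),$$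 $$C_{\mathcal I}=\tfrac12\big(\partial_{y_1}\partial_{y_2}\partial_{y_3}-\partial_{y_1}\partial_{x_2}\partial_{x_3}-\partial_{x_1}\partial_{y_2}\partial_{x_3}-\partial_{x_1}\partial_{x_2}\partial_{y_3}\big).$$ -/

import Mathlib

open scoped TensorProduct

noncomputable section

namespace FormalPoisson

variable (ι : Type) (𝕜 : Type) [CommRing 𝕜] [Algebra ℝ 𝕜]

/-- Formal multivector fields at `0 ∈ ℝ^ι` with coefficients in `𝕜⟦x⟧` (for `𝕜 = ℝ, ℂ`): the algebra
`𝕜⟦x⟧ ⊗ Λ(ℝ^ι)`, whose multiplication is the wedge product. The standard basis vector `e_b` of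
`ℝ^ι` stands for the coordinate vector field `∂/∂x_b`. -/
abbrev Multivector : Type :=
  MvPowerSeries ι 𝕜 ⊗[ℝ] ExteriorAlgebra ℝ (ι → ℝ)

/-- The formal `k`-vector fields `𝕜⟦x⟧ ⊗ Λ^k(ℝ^ι)`. -/
def degreePart (k : ℕ) : Submodule ℝ (Multivector ι 𝕜) :=
  LinearMap.range (LinearMap.lTensor (MvPowerSeries ι 𝕜) (⋀[ℝ]^k (ι → ℝ)).subtype)

variable {ι}

/-- The coordinate vector field `∂/∂x_b`. -/
def coordField [DecidableEq ι] (b : ι) : Multivector ι 𝕜 :=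
  1 ⊗ₜ[ℝ] ExteriorAlgebra.ι ℝ (Pi.single b (1 : ℝ))

variable {𝕜}

/-- Coefficientwise partial derivative `∂P/∂x_b` of a real formal multivector field. -/
def coeffDeriv (b : ι) : Multivector ι ℝ →ₗ[ℝ] Multivector ι ℝ :=
  LinearMap.rTensor (ExteriorAlgebra ℝ (ι → ℝ))
    (MvPowerSeries.pderiv ℝ b : MvPowerSeries ι ℝ →ₗ[ℝ] MvPowerSeries ι ℝ)

/-- Left contraction with the covector `dx_b`. -/
def contractL (b : ι) : Multivector ι ℝ →ₗ[ℝ] Multivector ι ℝ :=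
  LinearMap.lTensor (MvPowerSeries ι ℝ)
    (CliffordAlgebra.contractLeft (Q := (0 : QuadraticForm ℝ (ι → ℝ))) (LinearMap.proj b))

/-- Right contraction with the covector `dx_b`; on `k`-vector fields it is `(-1)^(k-1)` times the
left contraction. -/
def contractR (b : ι) : Multivector ι ℝ →ₗ[ℝ] Multivector ι ℝ :=
  LinearMap.lTensor (MvPowerSeries ι ℝ)
    ((CliffordAlgebra.contractRight (Q := (0 : QuadraticForm ℝ (ι → ℝ)))).flip (LinearMap.proj b))

/-- The Schouten–Nijenhuis bracket in coordinates:
`[P, Q] = ∑_b (P ⌊ dx_b) ∧ ∂_b Q - ∂_b P ∧ (dx_b ⌋ Q)`. It is the biderivation (in the graded sense)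
which extends the Lie bracket of vector fields and `[V, g] = V g`. -/
def schouten [Fintype ι] (P : Multivector ι ℝ) : Multivector ι ℝ →ₗ[ℝ] Multivector ι ℝ :=
  ∑ b : ι, (LinearMap.mulLeft ℝ (contractR b P) ∘ₗ coeffDeriv b -
    LinearMap.mulLeft ℝ (coeffDeriv b P) ∘ₗ contractL b)

variable [Fintype ι]

/-- Formal Poisson `k`-cocycles: formal `k`-vector fields `P` with `d_π P = [π, P] = 0`. -/
def cocycles (π : Multivector ι ℝ) (k : ℕ) : Submodule ℝ (Multivector ι ℝ) :=
  degreePart ι ℝ k ⊓ LinearMap.ker (schouten π)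

/-- Formal Poisson `k`-coboundaries: the fields `d_π Q = [π, Q]` with `Q` of degree `k - 1`. -/
def coboundaries (π : Multivector ι ℝ) : ℕ → Submodule ℝ (Multivector ι ℝ)
  | 0 => ⊥
  | k + 1 => (degreePart ι ℝ k).map (schouten π)

/-- The class of a formal multivector field modulo the formal Poisson `k`-coboundaries. -/
def cls (π : Multivector ι ℝ) (k : ℕ) :
    Multivector ι ℝ →ₗ[ℝ] Multivector ι ℝ ⧸ coboundaries π k :=
  (coboundaries π k).mkQ

/-- The formal Poisson cohomology `H^k_F` at `0` of the formal Poisson structure `π`: the space of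
classes of `k`-cocycles modulo `k`-coboundaries. -/
def cohomology (π : Multivector ι ℝ) (k : ℕ) :
    Submodule ℝ (Multivector ι ℝ ⧸ coboundaries π k) :=
  (cocycles π k).map (cls π k)

end FormalPoisson

namespace SL2C

open FormalPoisson

/-- Index set of the real coordinates on `𝔰𝔩₂(ℂ) ≅ ℂ³`: `Sum.inl j` is the index of `x_j` and
`Sum.inr j` is the index of `y_j`, where `z_j = x_j + i y_j`. -/
abbrev Coord : Type := Fin 3 ⊕ Fin 3

/-- Real formal power series in `x₁, x₂, x₃, y₁, y₂, y₃`. -/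
abbrev RSeries : Type := MvPowerSeries Coord ℝ

/-- Complex formal power series in the real coordinates `x₁, x₂, x₃, y₁, y₂, y₃`. -/
abbrev CSeries : Type := MvPowerSeries Coord ℂ

/-- Coefficientwise application of a real linear map `ℂ → ℝ` to a power series. -/
def mapSeries (φ : ℂ →ₗ[ℝ] ℝ) : CSeries →ₗ[ℝ] RSeries where
  toFun g := fun n => φ (MvPowerSeries.coeff n g)
  map_add' g h := by
    ext n
    exact φ.map_add _ _
  map_smul' r g := by
    ext n
    exact φ.map_smul r _

/-- Real part of a complex power series in real variables. -/
def reSeries : CSeries →ₗ[ℝ] RSeries := mapSeries Complex.reLm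

/-- Imaginary part of a complex power series in real variables. -/
def imSeries : CSeries →ₗ[ℝ] RSeries := mapSeries Complex.imLm

/-- Real part of a complex formal multivector field. -/
def rePart : Multivector Coord ℂ →ₗ[ℝ] Multivector Coord ℝ :=
  LinearMap.rTensor (ExteriorAlgebra ℝ (Coord → ℝ)) reSeries

/-- Imaginary part of a complex formal multivector field. -/
def imPart : Multivector Coord ℂ →ₗ[ℝ] Multivector Coord ℝ :=
  LinearMap.rTensor (ExteriorAlgebra ℝ (Coord → ℝ)) imSeries

/-- The complex scalar `c` as a constant power series. -/
def const (c : ℂ) : CSeries := MvPowerSeries.C c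

/-- The complex coordinate `z_j = x_j + i y_j`. -/
def z (j : Fin 3) : CSeries :=
  MvPowerSeries.X (Sum.inl j) + const Complex.I * MvPowerSeries.X (Sum.inr j)

/-- The complex vector field `∂/∂z_j = (∂/∂x_j - i ∂/∂y_j) / 2`. -/
def dz (j : Fin 3) : Multivector Coord ℂ :=
  const (1 / 2) • (coordField ℂ (Sum.inl j) - const Complex.I • coordField ℂ (Sum.inr j))

/-- The complex Poisson bivector
`π_ℂ = z₁ ∂_{z₂} ∧ ∂_{z₃} + z₂ ∂_{z₃} ∧ ∂_{z₁} + z₃ ∂_{z₁} ∧ ∂_{z₂}`. -/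
def piC : Multivector Coord ℂ :=
  z 0 • (dz 1 * dz 2) + z 1 • (dz 2 * dz 0) + z 2 • (dz 0 * dz 1)

/-- The linear Poisson structure `π = 4 Re π_ℂ` of the real Lie algebra `𝔰𝔩₂(ℂ)`. -/
def poisson : Multivector Coord ℝ := (4 : ℝ) • rePart piC

/-- The general element of `𝔰𝔩₂(ℂ)` in the coordinates `z₁, z₂, z₃`. -/
def genericMatrix : Matrix (Fin 2) (Fin 2) CSeries :=
  !![const Complex.I * z 0, -z 1 + const Complex.I * z 2;
    z 1 + const Complex.I * z 2, -(const Complex.I * z 0)]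

/-- The complex Casimir function `f = det`, which is `z₁² + z₂² + z₃²`. -/
def casimir : CSeries := genericMatrix.det

/-- The pair `(f₁, f₂)` of the real and imaginary parts of `f`. -/
def realCasimirs : Fin 2 → RSeries := ![reSeries casimir, imSeries casimir]

/-- The power series `g(f₁, f₂)`, for `g` a formal power series in two variables. -/
def evalCasimirs (g : MvPowerSeries (Fin 2) ℝ) : RSeries :=
  MvPowerSeries.subst realCasimirs g

/-- The complex-valued Cartan three-form `3 ∂_{z₁} ∧ ∂_{z₂} ∧ ∂_{z₃}`. -/
def cartan : Multivector Coord ℂ := (3 : ℝ) • (dz 0 * dz 1 * dz 2)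

/-- `C_R`, which is `4/3` of the real part of the Cartan three-form. -/
def CR : Multivector Coord ℝ := (4 / 3 : ℝ) • rePart cartan

/-- `C_I`, which is `4/3` of the imaginary part of the Cartan three-form. -/
def CI : Multivector Coord ℝ := (4 / 3 : ℝ) • imPart cartan

/-- The vector field `∂/∂x_j` on `𝔰𝔩₂(ℂ)` (indices start at `0`). -/
def dx (j : Fin 3) : Multivector Coord ℝ := coordField ℝ (Sum.inl j)

/-- The vector field `∂/∂y_j` on `𝔰𝔩₂(ℂ)` (indices start at `0`). -/
def dy (j : Fin 3) : Multivector Coord ℝ := coordField ℝ (Sum.inr j)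

theorem casimir_eq : casimir = z 0 ^ 2 + z 1 ^ 2 + z 2 ^ 2 := by
  have hI : const Complex.I * const Complex.I = -1 := by
    simp only [const, ← map_mul, Complex.I_mul_I, map_neg, map_one]
  rw [casimir, genericMatrix, Matrix.det_fin_two_of]
  linear_combination (-(z 0 ^ 2) - z 2 ^ 2) * hI

/-- The substitution of `(f₁, f₂)` into a power series in two variables is well defined. -/
theorem hasSubst_realCasimirs : MvPowerSeries.HasSubst realCasimirs := by
  have h : MvPowerSeries.constantCoeff casimir = 0 := by
    simp [casimir_eq, z]
  apply MvPowerSeries.hasSubst_of_constantCoeff_zero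
  intro s
  have hc (φ : ℂ →ₗ[ℝ] ℝ) : MvPowerSeries.constantCoeff (mapSeries φ casimir) = 0 := by
    have : MvPowerSeries.constantCoeff (mapSeries φ casimir)
      = φ (MvPowerSeries.constantCoeff casimir) := rfl
    rw [this, h, map_zero]
  fin_cases s
  · exact hc _
  · exact hc _

end SL2C

end

/-! Since π is linear, its formal complex is the Chevalley–Eilenberg complex of the real Lie algebra
𝔤 = 𝔰𝔩₂(ℂ) with coefficients in formal power series: d = Σ X_i ⊗ (e_i ∧) + 1 ⊗ δ, where X_i is the
hamiltonian field of the i-th coordinate and δ is the differential with trivial coefficients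
(`schouten_poisson`). For a semisimple 𝔤 the cohomology should be (invariant series) ⊗ H(𝔤). The
proof makes this explicit by a homotopy that works directly on formal series.

On coefficients, h = Σ ±X_a ⊗ ι_a satisfies dh + hd = Ω = Σ ±X_a², the Casimir operator
(`schouten_casimir_homotopy`). For the Fischer inner product, in which multiplication by a
coordinate is adjoint to the derivative, the X_a are skew for the x-coordinates and symmetric for
the y-coordinates. Hence -Ω is positive semidefinite in every degree and its kernel consists of the
invariants. So Ω has a pseudo-inverse T that is a polynomial in Ω on each homogeneous component and
commutes with all X_a; p = 1 - ΩT projects onto the invariant series.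

On constant multivectors, the Laplacian L = δδ* + δ*δ satisfies (L - 2)(L - 4) = 8q, with q the
projection onto the span of 1, C_R, C_I and C_R ∧ C_I. Then σ = δ*(6 - L)/8 satisfies δσ + σδ = 1 -
q (`delta_cohom`). These identities on a 64-dimensional space are verified by integer computation on
a basis. The operator hT + pσ contracts the complex onto the range of p ⊗ q, on both sides of which
d vanishes (`differential_homotopy`, `schouten_homotopy`).

It remains to see that the invariant series are exactly the series in f₁, f₂. Invariance of f says
that z × ∂_z f = 0. As z₁, z₂, z₃ are coprime, ∂_z f is a multiple of z (`exists_gradient`), and the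
real and imaginary parts of the factor are again invariant (`ham_gradient`). Euler's formula then
writes f in terms of f₁, f₂ and invariants of degree lower by two, and induction applies
(`mem_casSpan_sup_vanishing`). Uniqueness holds because (f₁, f₂) maps ℝ⁶ onto ℝ²
(`eq_zero_of_aeval_casPoly`). -/

noncomputable section

/-! ### A computable model of the exterior algebra -/

namespace ExteriorModel

/-- Sparse integer vectors arranged as binary trees: a model of the exterior algebra on generators
`e₀, e₁, …`, in which `node u v` stands for `u + e₀ ∧ v`, with the indices in `u` and `v` shifted
by one. -/
inductive Tree : Type
  | zero : Tree
  | leaf : ℤ → Tree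
  | node : Tree → Tree → Tree

namespace Tree

/-- Addition of a constant. -/
def addConst (z : ℤ) : Tree → Tree
  | zero => leaf z
  | leaf w => leaf (Int.add z w)
  | node u v => node (addConst z u) v

def add : Tree → Tree → Tree
  | zero, b => b
  | leaf z, b => addConst z b
  | node u v, zero => node u v
  | node u v, leaf z => node (addConst z u) v
  | node u v, node u' v' => node (add u u') (add v v')

def smul (z : ℤ) : Tree → Tree
  | zero => zero
  | leaf w => leaf (Int.mul z w)
  | node u v => node (smul z u) (smul z v)

/-- The constant coefficient. -/
def vac : Tree → ℤ
  | zero => 0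
  | leaf w => w
  | node u _ => vac u

/-- Left multiplication by the `k`-th generator. -/
def wedge : ℕ → Tree → Tree
  | _, zero => zero
  | 0, leaf z => node zero (leaf z)
  | 0, node u _ => node zero u
  | k + 1, leaf z => node (wedge k (leaf z)) zero
  | k + 1, node u v => node (wedge k u) (smul (-1) (wedge k v))

/-- Left contraction with the `k`-th dual generator. -/
def contr : ℕ → Tree → Tree
  | _, zero => zero
  | _, leaf _ => zero
  | 0, node _ v => node v zero
  | k + 1, node u v => node (contr k u) (smul (-1) (contr k v))

/-- Each level decides whether its generator occurs, which yields the 2ⁿ monomials in the first `n`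
generators. -/
def basis : ℕ → List Tree
  | 0 => [leaf 1]
  | n + 1 => (basis n).map (fun b => node b zero) ++ (basis n).map (fun b => node zero b)

def isZero : Tree → Bool
  | zero => true
  | leaf z => @decide (@Eq ℤ z 0) (Int.instDecidableEq z 0)
  | node u v => isZero u && isZero v

variable {E : Type*} [AddCommGroup E] [Module ℝ E]

/-- The element of the exterior algebra that a tree stands for, when the `k`-th generator
is `x k`. -/
def real : (ℕ → E) → Tree → ExteriorAlgebra ℝ E
  | _, zero => 0
  | _, leaf z => algebraMap ℝ _ (z : ℝ)
  | x, node u v => real (fun i => x (i + 1)) u +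
      ExteriorAlgebra.ι ℝ (x 0) * real (fun i => x (i + 1)) v

theorem real_addConst (x : ℕ → E) (z : ℤ) (a : Tree) :
    real x (addConst z a) = algebraMap ℝ _ (z : ℝ) + real x a := by
  induction a generalizing x with
  | zero => simp [real, addConst]
  | leaf w =>
    simp only [real, addConst, ← map_add]
    congr 1
    exact Int.cast_add (R := ℝ) z w
  | node u v h1 h2 => simp [real, addConst, h1, add_assoc]

theorem real_add (x : ℕ → E) (a b : Tree) : real x (add a b) = real x a + real x b := by
  fun_induction add a b generalizing x with
  | case1 => simp [real]
  | case2 => rw [real_addConst, real]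
  | case3 u v => simp [real]
  | case4 u v z => simp [real, real_addConst]; abel
  | case5 u v u' v' h1 h2 => simp [real, h1, h2, mul_add]; abel

theorem real_smul (x : ℕ → E) (z : ℤ) (a : Tree) : real x (smul z a) = (z : ℝ) • real x a := by
  induction a generalizing x with
  | zero => simp [real, smul]
  | leaf w =>
    simp only [real, smul, Algebra.algebraMap_eq_smul_one, smul_smul]
    congr 1
    exact Int.cast_mul (α := ℝ) z w
  | node u v h1 h2 => simp [real, smul, h1, h2]

theorem algebraMapInv_ι_mul (v : E) (a : ExteriorAlgebra ℝ E) :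
    ExteriorAlgebra.algebraMapInv (ExteriorAlgebra.ι ℝ v * a) = 0 := by
  simp [ExteriorAlgebra.algebraMapInv]

theorem algebraMapInv_real (x : ℕ → E) (a : Tree) :
    ExteriorAlgebra.algebraMapInv (real x a) = (vac a : ℝ) := by
  induction a generalizing x with
  | zero => simp [real, vac]
  | leaf w => simp [real, vac]
  | node u v h1 h2 => rw [real, map_add, algebraMapInv_ι_mul, h1, add_zero, vac]

theorem ι_mul_ι_comm (v w : E) (a : ExteriorAlgebra ℝ E) :
    ExteriorAlgebra.ι ℝ v * (ExteriorAlgebra.ι ℝ w * a) =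
      -(ExteriorAlgebra.ι ℝ w * (ExteriorAlgebra.ι ℝ v * a)) := by
  rw [← mul_assoc, ← mul_assoc, ← neg_mul, eq_neg_of_add_eq_zero_left
    (ExteriorAlgebra.ι_add_mul_swap v w)]

theorem real_wedge (x : ℕ → E) (k : ℕ) (a : Tree) :
    real x (wedge k a) = ExteriorAlgebra.ι ℝ (x k) * real x a := by
  fun_induction wedge k a generalizing x with
  | case1 => simp [real]
  | case2 => simp [real]
  | case3 u v => simp [real, mul_add, ← mul_assoc]
  | case4 k z h => simp [real, h]
  | case5 k u v h1 h2 =>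
    simp only [real, real_smul, h1, h2, mul_add]
    -- Moving the new factor past `x 0` produces the sign in the second branch.
    rw [ι_mul_ι_comm (x (k + 1)) (x 0)]
    simp

theorem contractLeft_ι_mul (d : Module.Dual ℝ E) (v : E) (a : ExteriorAlgebra ℝ E) :
    CliffordAlgebra.contractLeft (Q := (0 : QuadraticForm ℝ E)) d (ExteriorAlgebra.ι ℝ v * a) =
      d v • a - ExteriorAlgebra.ι ℝ v *
        CliffordAlgebra.contractLeft (Q := (0 : QuadraticForm ℝ E)) d a :=
  CliffordAlgebra.contractLeft_ι_mul (Q := (0 : QuadraticForm ℝ E)) (d := d) v a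

theorem contractLeft_algebraMap (d : Module.Dual ℝ E) (r : ℝ) :
    CliffordAlgebra.contractLeft (Q := (0 : QuadraticForm ℝ E)) d
      (algebraMap ℝ (ExteriorAlgebra ℝ E) r) = 0 :=
  CliffordAlgebra.contractLeft_algebraMap (Q := (0 : QuadraticForm ℝ E)) d r

/-- Used for the dual of `x 0`: both branches of a node involve only later generators, and these are
annihilated. -/
theorem contractLeft_real_eq_zero (d : Module.Dual ℝ E) (x : ℕ → E) (h : ∀ j, d (x j) = 0)
    (a : Tree) :
    CliffordAlgebra.contractLeft (Q := (0 : QuadraticForm ℝ E)) d (real x a) = 0 := by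
  induction a generalizing x with
  | zero => simp [real]
  | leaf z => exact contractLeft_algebraMap _ _
  | node u v h1 h2 =>
    rw [real, map_add, contractLeft_ι_mul, h1 _ (fun j => h _), h2 _ (fun j => h _), h]
    simp

theorem real_contr (d : Module.Dual ℝ E) (x : ℕ → E) (k : ℕ)
    (h : ∀ j, d (x j) = if j = k then 1 else 0) (a : Tree) :
    real x (contr k a) =
      CliffordAlgebra.contractLeft (Q := (0 : QuadraticForm ℝ E)) d (real x a) := by
  fun_induction contr k a generalizing x with
  | case1 => simp [real]
  | case2 => exact (contractLeft_algebraMap _ _).symm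
  | case3 u v =>
    have hd (j : ℕ) : d (x (j + 1)) = 0 := by rw [h, if_neg (by omega)]
    rw [real, real.eq_3 x, map_add, contractLeft_ι_mul, contractLeft_real_eq_zero _ _ hd,
      contractLeft_real_eq_zero _ _ hd, h]
    simp [real]
  | case4 k u v h1 h2 =>
    have hd (j : ℕ) : d (x (j + 1)) = if j = k then 1 else 0 := by rw [h]; simp
    rw [real, real, map_add, contractLeft_ι_mul, real_smul, h1 _ hd, h2 _ hd, h]
    simp

theorem real_eq_zero_of_isZero (x : ℕ → E) (a : Tree) (h : isZero a = true) : real x a = 0 := by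
  induction a generalizing x with
  | zero => rfl
  | leaf z =>
    have : z = 0 := @of_decide_eq_true (@Eq ℤ z 0) (Int.instDecidableEq z 0) h
    simp [real, this]
  | node u v h1 h2 =>
    simp only [isZero, Bool.and_eq_true] at h
    simp [real, h1 _ h.1, h2 _ h.2]

/-- The span of the basis vectors. -/
def basisSpan (n : ℕ) (x : ℕ → E) : Submodule ℝ (ExteriorAlgebra ℝ E) :=
  Submodule.span ℝ {y | ∃ b ∈ basis n, y = real x b}

theorem basisSpan_shift_le (n : ℕ) (x : ℕ → E) :
    basisSpan n (fun i => x (i + 1)) ≤ basisSpan (n + 1) x := by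
  refine Submodule.span_mono ?_
  rintro _ ⟨b, hb, rfl⟩
  exact ⟨node b zero, List.mem_append_left _ (List.mem_map_of_mem hb), by simp [real]⟩

theorem mul_mem_basisSpan (n : ℕ) (x : ℕ → E) {y : ExteriorAlgebra ℝ E}
    (hy : y ∈ basisSpan n (fun i => x (i + 1))) :
    ExteriorAlgebra.ι ℝ (x 0) * y ∈ basisSpan (n + 1) x := by
  have := Submodule.mem_map_of_mem (f := LinearMap.mulLeft ℝ (ExteriorAlgebra.ι ℝ (x 0))) hy
  rw [basisSpan, Submodule.map_span] at this
  refine Submodule.span_mono ?_ this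
  rintro _ ⟨_, ⟨b, hb, rfl⟩, rfl⟩
  exact ⟨node zero b, List.mem_append_right _ (List.mem_map_of_mem hb), by simp [real]⟩

theorem one_mem_basisSpan (n : ℕ) (x : ℕ → E) : 1 ∈ basisSpan n x := by
  induction n generalizing x with
  | zero => exact Submodule.subset_span ⟨leaf 1, List.mem_singleton_self _, by simp [real]⟩
  | succ n h => exact basisSpan_shift_le n x (h _)

/-- Splitting off `x 0` reduces to `n - 1` generators: later generators anticommute past `x 0`, and
`x 0` itself squares to zero. -/
theorem generator_mul_mem_basisSpan (n : ℕ) (x : ℕ → E) (k : ℕ) (hk : k < n)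
    (y : ExteriorAlgebra ℝ E) (hy : y ∈ basisSpan n x) :
    ExteriorAlgebra.ι ℝ (x k) * y ∈ basisSpan n x := by
  induction n generalizing x k y with
  | zero => omega
  | succ n h =>
    induction hy using Submodule.span_induction with
    | mem y hy =>
      obtain ⟨b, hb, rfl⟩ := hy
      rcases List.mem_append.1 hb with hb | hb
      · obtain ⟨b, hb₁, rfl⟩ := List.mem_map.1 hb
        have hb' : real (fun i => x (i + 1)) b ∈ basisSpan n (fun i => x (i + 1)) :=
          Submodule.subset_span ⟨b, hb₁, rfl⟩
        have : real x (node b zero) = real (fun i => x (i + 1)) b := by simp [real]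
        rw [this]
        cases k with
        | zero => exact mul_mem_basisSpan n x hb'
        | succ k => exact basisSpan_shift_le n x (h _ k (by omega) _ hb')
      · obtain ⟨b, hb₁, rfl⟩ := List.mem_map.1 hb
        have hb' : real (fun i => x (i + 1)) b ∈ basisSpan n (fun i => x (i + 1)) :=
          Submodule.subset_span ⟨b, hb₁, rfl⟩
        have : real x (node zero b) =
            ExteriorAlgebra.ι ℝ (x 0) * real (fun i => x (i + 1)) b := by simp [real]
        rw [this]
        cases k with
        | zero => rw [← mul_assoc, ExteriorAlgebra.ι_sq_zero, zero_mul]; exact zero_mem _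
        | succ k =>
          rw [ι_mul_ι_comm]
          exact neg_mem (mul_mem_basisSpan n x (h _ k (by omega) _ hb'))
    | zero => simp
    | add y z _ _ h1 h2 => rw [mul_add]; exact add_mem h1 h2
    | smul r y _ h => rw [mul_smul_comm]; exact Submodule.smul_mem _ _ h

/-- The span contains 1 and is stable under left multiplication by the generators, hence by every
vector. -/
theorem basisSpan_eq_top (n : ℕ) (x : ℕ → E)
    (hx : ⊤ ≤ Submodule.span ℝ {y | ∃ k < n, y = x k}) : basisSpan n x = ⊤ := by
  rw [eq_top_iff]
  rintro y -
  induction y using CliffordAlgebra.left_induction with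
  | algebraMap r =>
    rw [Algebra.algebraMap_eq_smul_one]
    exact Submodule.smul_mem _ _ (one_mem_basisSpan n x)
  | add y z h1 h2 => exact add_mem h1 h2
  | ι_mul y v hy =>
    have hv := hx (Submodule.mem_top (x := v))
    induction hv using Submodule.span_induction with
    | mem v hv =>
      obtain ⟨k, hk, rfl⟩ := hv
      exact generator_mul_mem_basisSpan n x k hk y hy
    | zero => simp
    | add v w _ _ h1 h2 => rw [map_add, add_mul]; exact add_mem h1 h2
    | smul r y _ h => rw [map_smul, smul_mul_assoc]; exact Submodule.smul_mem _ _ h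

end Tree

/-- Noncommutative polynomial expressions in wedge multiplications, contractions and the projection
to the scalars. -/
inductive Op : Type
  | one : Op
  | vac : Op
  | wedge : ℕ → Op
  | contr : ℕ → Op
  | add : Op → Op → Op
  | mul : Op → Op → Op
  | smul : ℤ → Op → Op

namespace Op

/-- The action of an expression on trees. -/
def apply : Op → Tree → Tree
  | one, a => a
  | vac, a => .leaf a.vac
  | wedge k, a => a.wedge k
  | contr k, a => a.contr k
  | add p q, a => (p.apply a).add (q.apply a)
  | mul p q, a => p.apply (q.apply a)
  | smul z p, a => (p.apply a).smul z

variable {E : Type*} [AddCommGroup E] [Module ℝ E]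

/-- The projection of the exterior algebra to its scalars, as an endomorphism. -/
def vacEnd : Module.End ℝ (ExteriorAlgebra ℝ E) :=
  (Algebra.linearMap ℝ (ExteriorAlgebra ℝ E)) ∘ₗ
    (ExteriorAlgebra.algebraMapInv (R := ℝ) (M := E)).toLinearMap

/-- The endomorphism of the exterior algebra given by an expression. -/
def eval (x : ℕ → E) (d : ℕ → Module.Dual ℝ E) : Op → Module.End ℝ (ExteriorAlgebra ℝ E)
  | one => 1
  | vac => vacEnd
  | wedge k => LinearMap.mulLeft ℝ (ExteriorAlgebra.ι ℝ (x k))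
  | contr k => CliffordAlgebra.contractLeft (Q := (0 : QuadraticForm ℝ E)) (d k)
  | add p q => p.eval x d + q.eval x d
  | mul p q => p.eval x d * q.eval x d
  | smul z p => (z : ℝ) • p.eval x d

/-- All indices of contractions are less than `n`. -/
def bounded (n : ℕ) : Op → Bool
  | one => true
  | vac => true
  | wedge _ => true
  | contr k => Nat.blt k n
  | add p q => p.bounded n && q.bounded n
  | mul p q => p.bounded n && q.bounded n
  | smul _ p => p.bounded n

/-- The bound matters only for contractions: `d k` is assumed dual to the generators only for `k <
n`. -/
theorem eval_real {n : ℕ} {x : ℕ → E} {d : ℕ → Module.Dual ℝ E}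
    (hd : ∀ k < n, ∀ j, d k (x j) = if j = k then 1 else 0)
    (p : Op) (h : p.bounded n = true) (a : Tree) :
    p.eval x d (a.real x) = (p.apply a).real x := by
  induction p generalizing a with
  | one => rfl
  | vac =>
    simp only [eval, apply, Tree.real, ← Tree.algebraMapInv_real x a]
    rfl
  | wedge k => exact (Tree.real_wedge x k a).symm
  | contr k =>
    have hk : k < n := by simpa [bounded] using h
    exact (Tree.real_contr (d k) x k (hd k hk) a).symm
  | add p q hp hq =>
    simp only [bounded, Bool.and_eq_true] at h
    simp only [eval, apply, Tree.real_add, LinearMap.add_apply, hp h.1, hq h.2]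
  | mul p q hp hq =>
    simp only [bounded, Bool.and_eq_true] at h
    simp only [eval, apply, Module.End.mul_apply, hp h.1, hq h.2]
  | smul z p hp =>
    simp only [bounded] at h
    simp only [eval, apply, Tree.real_smul, LinearMap.smul_apply, hp h]

/-- Two expressions agree on the basis of the exterior algebra on `n` generators. -/
def check (n : ℕ) (p q : Op) : Bool :=
  p.bounded n && q.bounded n &&
    (Tree.basis n).all (fun b => ((p.apply b).add ((q.apply b).smul (-1))).isZero)

/-- Linear maps that agree on a spanning set coincide, so an operator identity becomes a finite
integer computation. -/
theorem eval_eq_of_check {n : ℕ} {x : ℕ → E} {d : ℕ → Module.Dual ℝ E}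
    (hd : ∀ k < n, ∀ j, d k (x j) = if j = k then 1 else 0)
    (hx : ⊤ ≤ Submodule.span ℝ {y | ∃ k < n, y = x k}) {p q : Op} (h : check n p q = true) :
    p.eval x d = q.eval x d := by
  simp only [check, Bool.and_eq_true, List.all_eq_true] at h
  refine LinearMap.ext_on (Tree.basisSpan_eq_top n x hx) ?_
  rintro _ ⟨b, hb, rfl⟩
  rw [eval_real hd p h.1.1, eval_real hd q h.1.2]
  have := Tree.real_eq_zero_of_isZero x _ (h.2 b hb)
  rw [Tree.real_add, Tree.real_smul] at this
  simpa [sub_eq_zero, ← sub_eq_add_neg] using this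

end Op

end ExteriorModel
end

/-! ### The differential, its adjoint and the invariants on constant multivectors -/

noncomputable section
open ExteriorModel
namespace SL2C

/-- The part of the Chevalley–Eilenberg differential which comes from the brackets landing in the
`c`-th coordinates, for a cyclic permutation `a, b, c` of `0, 1, 2`. -/
def deltaOpAux (a b c : ℕ) : Op :=
  .add (.add (.smul (-1) (.mul (.wedge a) (.mul (.wedge b) (.contr c))))
      (.mul (.wedge (a + 3)) (.mul (.wedge (b + 3)) (.contr c))))
    (.add (.smul (-1) (.mul (.wedge a) (.mul (.wedge (b + 3)) (.contr (c + 3)))))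
      (.mul (.wedge b) (.mul (.wedge (a + 3)) (.contr (c + 3)))))

/-- The Chevalley–Eilenberg differential with trivial coefficients. -/
def deltaOp : Op := .add (deltaOpAux 0 1 2) (.add (deltaOpAux 1 2 0) (deltaOpAux 2 0 1))

/-- Each monomial of `deltaOpAux` is transposed: wedges and contractions are exchanged and the order
is reversed. This is the adjoint for the inner product in which the coordinate monomials are
orthonormal. -/
def codeltaOpAux (a b c : ℕ) : Op :=
  .add (.add (.smul (-1) (.mul (.wedge c) (.mul (.contr b) (.contr a))))
      (.mul (.wedge c) (.mul (.contr (b + 3)) (.contr (a + 3)))))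
    (.add (.smul (-1) (.mul (.wedge (c + 3)) (.mul (.contr (b + 3)) (.contr a))))
      (.mul (.wedge (c + 3)) (.mul (.contr (a + 3)) (.contr b))))

/-- The adjoint of the Chevalley–Eilenberg differential. -/
def codeltaOp : Op :=
  .add (codeltaOpAux 0 1 2) (.add (codeltaOpAux 1 2 0) (codeltaOpAux 2 0 1))

def laplaceOp : Op := .add (.mul deltaOp codeltaOp) (.mul codeltaOp deltaOp)

/-- Wedge multiplication with `2 C_R`. -/
def crOp : Op :=
  .add (.add (.mul (.wedge 0) (.mul (.wedge 1) (.wedge 2)))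
      (.smul (-1) (.mul (.wedge 3) (.mul (.wedge 4) (.wedge 2)))))
    (.add (.smul (-1) (.mul (.wedge 0) (.mul (.wedge 4) (.wedge 5))))
      (.smul (-1) (.mul (.wedge 3) (.mul (.wedge 1) (.wedge 5)))))

/-- Wedge multiplication with `2 C_I`. -/
def ciOp : Op :=
  .add (.add (.mul (.wedge 3) (.mul (.wedge 4) (.wedge 5)))
      (.smul (-1) (.mul (.wedge 3) (.mul (.wedge 1) (.wedge 2)))))
    (.add (.smul (-1) (.mul (.wedge 0) (.mul (.wedge 4) (.wedge 2))))
      (.smul (-1) (.mul (.wedge 0) (.mul (.wedge 1) (.wedge 5)))))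

/-- Contraction with twice the three-vector dual to `C_R`. -/
def crDualOp : Op :=
  .add (.add (.mul (.contr 2) (.mul (.contr 1) (.contr 0)))
      (.smul (-1) (.mul (.contr 2) (.mul (.contr 4) (.contr 3)))))
    (.add (.smul (-1) (.mul (.contr 5) (.mul (.contr 4) (.contr 0))))
      (.smul (-1) (.mul (.contr 5) (.mul (.contr 1) (.contr 3)))))

def ciDualOp : Op :=
  .add (.add (.mul (.contr 5) (.mul (.contr 4) (.contr 3)))
      (.smul (-1) (.mul (.contr 2) (.mul (.contr 1) (.contr 3)))))
    (.add (.smul (-1) (.mul (.contr 2) (.mul (.contr 4) (.contr 0))))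
      (.smul (-1) (.mul (.contr 5) (.mul (.contr 1) (.contr 0)))))

def topDualOp : Op := .mul ciDualOp crDualOp

/-- Sixteen times the projection onto the invariants. -/
def projOp : Op :=
  .add (.add (.smul 16 .vac) (.smul 4 (.mul crOp (.mul .vac crDualOp))))
    (.add (.smul 4 (.mul ciOp (.mul .vac ciDualOp)))
      (.mul (.mul crOp ciOp) (.mul .vac topDualOp)))

theorem check_delta_delta : (Op.mul deltaOp deltaOp).check 6 (.smul 0 .one) = true := by
  decide +kernel

/-- This is 2(L - 2)(L - 4) = 16q: on the kernel of q, the Laplacian has no eigenvalues other than 2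
and 4. -/
theorem check_laplace : (Op.mul (.add laplaceOp (.smul (-2) .one))
    (.smul 2 (.add laplaceOp (.smul (-4) .one)))).check 6 projOp = true := by
  decide +kernel

theorem check_delta_proj : (Op.mul deltaOp projOp).check 6 (.smul 0 .one) = true := by
  decide +kernel

theorem check_proj_delta : (Op.mul projOp deltaOp).check 6 (.smul 0 .one) = true := by
  decide +kernel
end SL2C
end

/-! ### Pseudo-inverses of operators on formal power series -/

noncomputable section

namespace FormalPoisson

open MvPowerSeries

section PseudoInverse

variable {K U W : Type*} [Field K] [AddCommGroup U] [Module K U] [AddCommGroup W] [Module K W]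

theorem aeval_apply_of_semiconj (p : U →ₗ[K] W) (A : Module.End K U) (B : Module.End K W)
    (h : ∀ x, p (A x) = B (p x)) (P : Polynomial K) (x : U) :
    p (Polynomial.aeval A P x) = Polynomial.aeval B P (p x) := by
  induction P using Polynomial.induction_on' generalizing x with
  | add P Q hP hQ => simp [hP, hQ]
  | monomial n a =>
    simp only [Polynomial.aeval_monomial, Module.End.mul_apply, Module.algebraMap_end_apply,
      map_smul]
    congr 1
    induction n generalizing x with
    | zero => simp
    | succ n ih => rw [pow_succ, pow_succ, Module.End.mul_apply, Module.End.mul_apply, ih, h]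

/-- Write the minimal polynomial as X^k q with q(0) ≠ 0. Since ker B² = ker B, the power X^k may be
replaced by X, so B q(B) = 0. Division by q(0) brings X q to the form X - X² u. -/
theorem exists_aeval_eq_zero_of_ker_sq_le [FiniteDimensional K U] (B : Module.End K U)
    (h : ∀ x, B (B x) = 0 → B x = 0) :
    ∃ u : Polynomial K, Polynomial.aeval B (Polynomial.X - Polynomial.X ^ 2 * u) = 0 := by
  have hp : minpoly K B ≠ 0 := minpoly.ne_zero (Algebra.IsIntegral.isIntegral B)
  obtain ⟨q, hq, hdvd⟩ := Polynomial.exists_eq_pow_rootMultiplicity_mul_and_not_dvd _ hp 0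
  rw [map_zero, sub_zero] at hq hdvd
  generalize (minpoly K B).rootMultiplicity 0 = k at hq
  have hpow (k : ℕ) (x : U) (hx : (B ^ k) x = 0) : B x = 0 := by
    induction k with
    | zero => simp_all
    | succ k ih =>
      cases k with
      | zero => simpa using hx
      | succ k =>
        apply ih
        rw [pow_succ', Module.End.mul_apply] at hx ⊢
        rw [pow_succ', Module.End.mul_apply] at hx
        exact h _ hx
  have hBq : B * Polynomial.aeval B q = 0 := by
    ext x
    refine hpow k _ ?_
    have := congrArg (fun P => Polynomial.aeval B P x) hq
    simpa using this.symm
  have h0 : q.coeff 0 ≠ 0 := fun h0 => hdvd (Polynomial.X_dvd_iff.2 h0)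
  refine ⟨-(Polynomial.C (q.coeff 0)⁻¹ * q.divX), ?_⟩
  have : (Polynomial.X - Polynomial.X ^ 2 * -(Polynomial.C (q.coeff 0)⁻¹ * q.divX)) =
      Polynomial.C (q.coeff 0)⁻¹ * (Polynomial.X * q) := by
    have hC : Polynomial.C (q.coeff 0)⁻¹ * Polynomial.C (q.coeff 0) = (1 : Polynomial K) := by
      rw [← map_mul, inv_mul_cancel₀ h0, map_one]
    linear_combination (-Polynomial.X) * hC +
      (Polynomial.C (q.coeff 0)⁻¹ * Polynomial.X) * Polynomial.divX_mul_X_add q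
  rw [this, map_mul, map_mul, Polynomial.aeval_X, hBq, mul_zero]

end PseudoInverse

/-! ### Homogeneous components -/

section Degree

variable {ι : Type}

/-- The exponents of degree `n`. -/
def exponents (ι : Type) [Fintype ι] [DecidableEq ι] (n : ℕ) : Finset (ι →₀ ℕ) :=
  Finset.finsuppAntidiag Finset.univ n

theorem mem_exponents [Fintype ι] [DecidableEq ι] {n : ℕ} {α : ι →₀ ℕ} : α ∈ exponents ι n ↔ α.degree = n := by
  simp [exponents, Finset.mem_finsuppAntidiag, Finsupp.degree_eq_sum]

variable (ι) in
/-- The series whose homogeneous component of degree `n` vanishes. -/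
def vanishing (n : ℕ) : Submodule ℝ (MvPowerSeries ι ℝ) where
  carrier := {f | ∀ α : ι →₀ ℕ, α.degree = n → coeff α f = 0}
  add_mem' hf hg α h := by rw [map_add, hf α h, hg α h, add_zero]
  zero_mem' _ _ := map_zero _
  smul_mem' r f hf α h := by rw [map_smul, hf α h, smul_zero]

theorem mem_vanishing {n : ℕ} {f : MvPowerSeries ι ℝ} :
    f ∈ vanishing ι n ↔ ∀ α : ι →₀ ℕ, α.degree = n → coeff α f = 0 := Iff.rfl

theorem eq_zero_of_forall_mem_vanishing {f : MvPowerSeries ι ℝ} (h : ∀ n, f ∈ vanishing ι n) :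
    f = 0 := by
  ext α
  exact h _ α rfl

/-- The quotient stands for the homogeneous component of degree `n`, which is determined by finitely
many coefficients. -/
instance finite_quotient_vanishing [Fintype ι] (n : ℕ) :
    FiniteDimensional ℝ (MvPowerSeries ι ℝ ⧸ vanishing ι n) := by
  classical
  let φ : MvPowerSeries ι ℝ →ₗ[ℝ] (exponents ι n → ℝ) := LinearMap.pi fun α => coeff α.1
  have hφ : vanishing ι n = LinearMap.ker φ := by
    ext f
    simp only [mem_vanishing, LinearMap.mem_ker, funext_iff, φ, LinearMap.pi_apply,
      Pi.zero_apply, Subtype.forall, mem_exponents]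
  rw [hφ]
  exact Module.Finite.equiv φ.quotKerEquivRange.symm

/-- The operator preserves the degree of homogeneous components. -/
def PreservesDegree (A : Module.End ℝ (MvPowerSeries ι ℝ)) : Prop :=
  ∀ n f, f ∈ vanishing ι n → A f ∈ vanishing ι n

/-- The hypothesis `h` says that A and A² have the same kernel on every homogeneous component. There
a polynomial u in A satisfies A = A² u(A), and a polynomial in A commutes with whatever commutes
with A. -/
theorem exists_pseudoInverse [Fintype ι] (A : Module.End ℝ (MvPowerSeries ι ℝ)) (hA : PreservesDegree A)
    (h : ∀ n f, A (A f) ∈ vanishing ι n → A f ∈ vanishing ι n) :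
    ∃ T : Module.End ℝ (MvPowerSeries ι ℝ), A * (1 - A * T) = 0 ∧
      ∀ B, PreservesDegree B → A * B = B * A → T * B = B * T := by
  have hu (n : ℕ) : ∃ u : Polynomial ℝ, ∀ f,
      A f - A (A (Polynomial.aeval A u f)) ∈ vanishing ι n := by
    obtain ⟨u, hu⟩ := exists_aeval_eq_zero_of_ker_sq_le
      ((vanishing ι n).mapQ (vanishing ι n) A (hA n)) (by
        intro x
        obtain ⟨f, rfl⟩ := (vanishing ι n).mkQ_surjective x
        simp only [Submodule.mkQ_apply, Submodule.mapQ_apply, Submodule.Quotient.mk_eq_zero]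
        exact h n f)
    refine ⟨u, fun f => ?_⟩
    have h1 := aeval_apply_of_semiconj (vanishing ι n).mkQ A
      ((vanishing ι n).mapQ (vanishing ι n) A (hA n)) (fun x => rfl)
      (Polynomial.X - Polynomial.X ^ 2 * u) f
    rw [hu, LinearMap.zero_apply] at h1
    have h2 := (Submodule.Quotient.mk_eq_zero _).1 h1
    simpa [pow_two] using h2
  choose u hu using hu
  -- The polynomial depends on the degree, so T is assembled coefficient by coefficient. It agrees
  -- with `u n` applied to A in degree `n` only.
  let T : Module.End ℝ (MvPowerSeries ι ℝ) :=
    { toFun f := fun α => coeff α (Polynomial.aeval A (u α.degree) f)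
      map_add' f g := by
        ext α
        exact (congrArg (coeff α) (map_add (Polynomial.aeval A (u α.degree)) f g)).trans
          (map_add _ _ _)
      map_smul' r f := by
        ext α
        exact (congrArg (coeff α) (map_smul (Polynomial.aeval A (u α.degree)) r f)).trans
          (map_smul _ _ _) }
  have hT (n : ℕ) (f) : T f - Polynomial.aeval A (u n) f ∈ vanishing ι n := by
    rintro α rfl
    rw [map_sub]
    exact sub_self _
  refine ⟨T, ?_, fun B hB hAB => ?_⟩
  · ext1 f
    refine eq_zero_of_forall_mem_vanishing fun n => ?_
    have h1 := Submodule.sub_mem _ (hu n f) (hA n _ (hA n _ (hT n f)))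
    simpa [mul_sub] using h1
  · ext1 f
    rw [← sub_eq_zero]
    refine eq_zero_of_forall_mem_vanishing fun n => ?_
    have h1 := Submodule.sub_mem _ (hT n (B f)) (hB n _ (hT n f))
    have h2 : Polynomial.aeval A (u n) (B f) = B (Polynomial.aeval A (u n) f) :=
      (aeval_apply_of_semiconj B A A (fun x => (LinearMap.congr_fun hAB x).symm) (u n) f).symm
    rw [h2, map_sub] at h1
    simpa using h1

end Degree

/-! ### Linear vector fields and the Fischer inner product -/

section Operators

variable {ι : Type}

/-- Multiplication by a coordinate. -/
def mulX (k : ι) : Module.End ℝ (MvPowerSeries ι ℝ) := LinearMap.mulLeft ℝ (X k)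

/-- Partial derivative. -/
def partialD (k : ι) : Module.End ℝ (MvPowerSeries ι ℝ) := (pderiv ℝ k).toLinearMap

@[simp] theorem mulX_apply (k : ι) (f : MvPowerSeries ι ℝ) : mulX k f = X k * f := rfl

@[simp] theorem partialD_apply (k : ι) (f : MvPowerSeries ι ℝ) : partialD k f = pderiv ℝ k f := rfl

theorem mulX_comm (k l : ι) : mulX k * mulX l = mulX l * mulX k := by
  ext1 f
  simp [mul_left_comm]

theorem pderiv_comm (k l : ι) (f : MvPowerSeries ι ℝ) :
    pderiv ℝ k (pderiv ℝ l f) = pderiv ℝ l (pderiv ℝ k f) := by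
  classical
  by_cases h : k = l
  · rw [h]
  · ext α
    simp only [coeff_pderiv, Finsupp.add_apply, Finsupp.single_apply, h, Ne.symm h, if_false,
      add_zero]
    rw [add_right_comm]
    ring

theorem partialD_comm (k l : ι) : partialD k * partialD l = partialD l * partialD k := by
  ext1 f
  exact pderiv_comm k l f

theorem partialD_mulX [DecidableEq ι] (k l : ι) :
    partialD k * mulX l = mulX l * partialD k + if l = k then 1 else 0 := by
  ext1 f
  simp only [Module.End.mul_apply, mulX_apply, partialD_apply, Derivation.leibniz,
    LinearMap.add_apply, pderiv_X, smul_eq_mul]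
  congr 1
  split_ifs <;> simp_all

/-- The second-order parts of the two products coincide, since coordinates commute among themselves
and so do derivatives. -/
theorem mulX_partialD_commutator [DecidableEq ι] (k m l n : ι) :
    (mulX k * partialD m) * (mulX l * partialD n) - (mulX l * partialD n) * (mulX k * partialD m) =
      (if l = m then mulX k * partialD n else 0) - if k = n then mulX l * partialD m else 0 := by
  have h1 : (mulX k * partialD m) * (mulX l * partialD n) =
      mulX k * mulX l * (partialD m * partialD n) +
        if l = m then mulX k * partialD n else 0 := by
    rw [mul_assoc, ← mul_assoc (partialD m), partialD_mulX]
    split_ifs <;> simp [mul_add, add_mul, mul_assoc]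
  have h2 : (mulX l * partialD n) * (mulX k * partialD m) =
      mulX k * mulX l * (partialD m * partialD n) +
        if k = n then mulX l * partialD m else 0 := by
    rw [mul_assoc, ← mul_assoc (partialD n), partialD_mulX, mulX_comm k l, partialD_comm m n]
    split_ifs <;> simp [mul_add, add_mul, mul_assoc]
  rw [h1, h2]
  abel

variable [Fintype ι]

/-- The linear vector field with matrix `A`. -/
def linearField (A : ι → ι → ℝ) : Module.End ℝ (MvPowerSeries ι ℝ) :=
  ∑ m, ∑ k, A m k • (mulX k * partialD m)

/-- The matrix entry `A m k` multiplies x_k ∂_m, so passing from matrices to vector fields reverses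
products: the bracket has matrix BA - AB. -/
theorem linearField_commutator (A B : ι → ι → ℝ) :
    linearField A * linearField B - linearField B * linearField A =
      linearField (fun m k => ∑ n, (B m n * A n k - A m n * B n k)) := by
  classical
  have hA (A : ι → ι → ℝ) : linearField A =
      ∑ p : ι × ι, A p.1 p.2 • (mulX p.2 * partialD p.1) := by
    rw [linearField, Fintype.sum_prod_type]
  have h : linearField A * linearField B - linearField B * linearField A =
      ∑ p : ι × ι, ∑ q : ι × ι, (A p.1 p.2 * B q.1 q.2) •
        ((mulX p.2 * partialD p.1) * (mulX q.2 * partialD q.1) -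
          (mulX q.2 * partialD q.1) * (mulX p.2 * partialD p.1)) := by
    simp only [smul_sub, Finset.sum_sub_distrib]
    congr 1
    · simp only [hA, Finset.sum_mul_sum, smul_mul_smul_comm]
    · simp only [hA, Finset.sum_mul_sum, smul_mul_smul_comm]
      rw [Finset.sum_comm]
      simp only [mul_comm]
  have h1 (m k : ι) : ∑ n, ∑ l, (A m k * B n l) •
        (if l = m then mulX k * partialD n else (0 : Module.End ℝ (MvPowerSeries ι ℝ))) =
      ∑ n, (A m k * B n m) • (mulX k * partialD n) := by simp
  have h2 (m k : ι) : ∑ n, ∑ l, (A m k * B n l) •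
        (if k = n then mulX l * partialD m else (0 : Module.End ℝ (MvPowerSeries ι ℝ))) =
      ∑ l, (A m k * B k l) • (mulX l * partialD m) := by
    rw [Finset.sum_comm]
    simp
  rw [h]
  simp only [mulX_partialD_commutator, smul_sub, Finset.sum_sub_distrib, Fintype.sum_prod_type,
    h1, h2, linearField]
  have h3 : ∑ m, ∑ k, ∑ n, (A m k * B n m) • (mulX k * partialD n) =
      ∑ m, ∑ k, ∑ n, (B m n * A n k) • (mulX k * partialD m) := by
    rw [Finset.sum_comm]
    conv_rhs => rw [Finset.sum_comm]
    refine Finset.sum_congr rfl fun k _ => ?_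
    rw [Finset.sum_comm]
    simp only [mul_comm]
  have h4 : ∑ m, ∑ k, ∑ l, (A m k * B k l) • (mulX l * partialD m) =
      ∑ m, ∑ l, ∑ k, (A m k * B k l) • (mulX l * partialD m) :=
    Finset.sum_congr rfl fun m _ => Finset.sum_comm
  rw [h3, h4]
  simp only [← Finset.sum_sub_distrib]
  refine Finset.sum_congr rfl fun m _ => Finset.sum_congr rfl fun k _ => ?_
  rw [Finset.sum_smul]
  simp only [sub_smul]

/-- The homogeneous component of degree `n` of the Fischer inner product. -/
def fischer [DecidableEq ι] (n : ℕ) (f g : MvPowerSeries ι ℝ) : ℝ :=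
  ∑ α ∈ exponents ι n, (∏ i, ((α i).factorial : ℝ)) * coeff α f * coeff α g

variable [DecidableEq ι]

theorem fischer_comm (n : ℕ) (f g : MvPowerSeries ι ℝ) : fischer n f g = fischer n g f := by
  simp only [fischer, mul_right_comm]

theorem fischer_smul_left (n : ℕ) (r : ℝ) (f h : MvPowerSeries ι ℝ) :
    fischer n (r • f) h = r * fischer n f h := by
  simp only [fischer, map_smul, Finset.mul_sum, smul_eq_mul]
  exact Finset.sum_congr rfl fun _ _ => by ring

theorem fischer_sum_left {κ : Type*} (s : Finset κ) (n : ℕ) (f : κ → MvPowerSeries ι ℝ)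
    (h : MvPowerSeries ι ℝ) : fischer n (∑ i ∈ s, f i) h = ∑ i ∈ s, fischer n (f i) h := by
  simp only [fischer, map_sum, Finset.mul_sum, Finset.sum_mul]
  exact Finset.sum_comm

theorem fischer_self_nonneg (n : ℕ) (f : MvPowerSeries ι ℝ) : 0 ≤ fischer n f f :=
  Finset.sum_nonneg fun α _ => by
    rw [mul_assoc]
    exact mul_nonneg (by positivity) (mul_self_nonneg _)

theorem mem_vanishing_of_fischer_self_eq_zero {n : ℕ} {f : MvPowerSeries ι ℝ}
    (h : fischer n f f = 0) : f ∈ vanishing ι n := by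
  intro α hα
  have := (Finset.sum_eq_zero_iff_of_nonneg fun α _ => by
    rw [mul_assoc]
    exact mul_nonneg (by positivity) (mul_self_nonneg _)).1 h α (mem_exponents.2 hα)
  rw [mul_assoc, mul_eq_zero, mul_self_eq_zero] at this
  refine this.resolve_left ?_
  positivity

theorem fischer_eq_zero_of_mem_vanishing {n : ℕ} {f : MvPowerSeries ι ℝ}
    (h : f ∈ vanishing ι n) (g : MvPowerSeries ι ℝ) : fischer n f g = 0 :=
  Finset.sum_eq_zero fun α hα => by rw [h α (mem_exponents.1 hα)]; ring

/-- The weight α! is made for this: (α + e_k)! = α! (α_k + 1), and α_k + 1 is the factor produced by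
∂_k. -/
theorem fischer_mulX (n : ℕ) (k : ι) (f g : MvPowerSeries ι ℝ) :
    fischer (n + 1) (mulX k f) g = fischer n f (partialD k g) := by
  have hinj : Function.Injective (fun α : ι →₀ ℕ => α + Finsupp.single k 1) :=
    add_left_injective _
  have hsub : (exponents ι n).map ⟨_, hinj⟩ ⊆ exponents ι (n + 1) := by
    intro β hβ
    obtain ⟨α, hα, rfl⟩ := Finset.mem_map.1 hβ
    rw [mem_exponents] at hα ⊢
    simp [hα]
  rw [fischer, ← Finset.sum_subset hsub, Finset.sum_map, fischer]
  · refine Finset.sum_congr rfl fun α _ => ?_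
    have h1 : coeff (α + Finsupp.single k 1) (mulX k f) = coeff α f := by
      rw [mulX_apply, add_comm, X, coeff_add_monomial_mul, one_mul]
    have h2 : (∏ i, (((α + Finsupp.single k 1 : ι →₀ ℕ) i).factorial : ℝ)) =
        (∏ i, ((α i).factorial : ℝ)) * (α k + 1) := by
      rw [← Finset.mul_prod_erase _ _ (Finset.mem_univ k),
        ← Finset.mul_prod_erase _ (fun i => ((α i).factorial : ℝ)) (Finset.mem_univ k)]
      have : ∏ i ∈ Finset.univ.erase k, (((α + Finsupp.single k 1 : ι →₀ ℕ) i).factorial : ℝ) =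
          ∏ i ∈ Finset.univ.erase k, ((α i).factorial : ℝ) :=
        Finset.prod_congr rfl fun i hi => by
          rw [Finsupp.add_apply, Finsupp.single_eq_of_ne (Finset.ne_of_mem_erase hi), add_zero]
      rw [this]
      simp [Nat.factorial_succ]
      ring
    simp only [Function.Embedding.coeFn_mk]
    rw [h1, h2, partialD_apply, coeff_pderiv]
    ring
  -- Exponents that are not of the form α + e_k do not occur in a multiple of x_k.
  · intro β hβ hn
    have : coeff β (mulX k f) = 0 := by
      rw [mulX_apply, X, coeff_monomial_mul, if_neg]
      intro hle
      refine hn (Finset.mem_map.2 ⟨β - Finsupp.single k 1, ?_, tsub_add_cancel_of_le hle⟩)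
      rw [mem_exponents] at hβ ⊢
      have h := congrArg Finsupp.degree (tsub_add_cancel_of_le hle)
      rw [map_add, Finsupp.degree_single, hβ] at h
      omega
    rw [this]
    ring

theorem fischer_zero_mulX (k : ι) (f g : MvPowerSeries ι ℝ) : fischer 0 (mulX k f) g = 0 := by
  refine fischer_eq_zero_of_mem_vanishing (fun α hα => ?_) _
  rw [Finsupp.degree_eq_zero_iff] at hα
  simp [hα]

theorem fischer_mulX_partialD (n : ℕ) (k m : ι) (f g : MvPowerSeries ι ℝ) :
    fischer n ((mulX k * partialD m) f) g = fischer n f ((mulX m * partialD k) g) := by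
  rw [fischer_comm n f]
  simp only [Module.End.mul_apply]
  cases n with
  | zero => simp only [fischer_zero_mulX]
  | succ n => rw [fischer_mulX, fischer_mulX, fischer_comm]

theorem fischer_linearField (n : ℕ) (A : ι → ι → ℝ) (f g : MvPowerSeries ι ℝ) :
    fischer n (linearField A f) g = fischer n f (linearField (fun m k => A k m) g) := by
  rw [fischer_comm n f]
  simp only [linearField, LinearMap.sum_apply, LinearMap.smul_apply, fischer_sum_left,
    fischer_smul_left, fischer_mulX_partialD]
  rw [Finset.sum_comm]
  refine Finset.sum_congr rfl fun k _ => Finset.sum_congr rfl fun m _ => ?_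
  rw [fischer_comm n g, fischer_mulX_partialD n k m]

-- By adjointness, ⟨Af, Af⟩ = ⟨f, AᵗAf⟩, which vanishes in degree `n` as soon as f does.
omit [DecidableEq ι] in
theorem preservesDegree_linearField (A : ι → ι → ℝ) : PreservesDegree (linearField A) := by
  classical
  intro n f hf
  refine mem_vanishing_of_fischer_self_eq_zero ?_
  rw [fischer_linearField, fischer_eq_zero_of_mem_vanishing hf]

end Operators

end FormalPoisson
end

/-! ### Structure constants, hamiltonian fields and the Casimir operator -/

noncomputable section

namespace SL2C

open FormalPoisson MvPowerSeries

/-- The totally antisymmetric symbol. -/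
def eps : Fin 3 → Fin 3 → Fin 3 → ℤ :=
  ![![![0, 0, 0], ![0, 0, 1], ![0, -1, 0]],
    ![![0, 0, -1], ![0, 0, 0], ![1, 0, 0]],
    ![![0, 1, 0], ![-1, 0, 0], ![0, 0, 0]]]

/-- The structure constants of `𝔰𝔩₂(ℂ)` as a real Lie algebra: `{i, j} = ∑ k, str i j k • k`. -/
def str : Coord → Coord → Coord → ℤ
  | .inl a, .inl b, .inl c => eps a b c
  | .inr a, .inr b, .inl c => -eps a b c
  | .inl a, .inr b, .inr c => eps a b c
  | .inr a, .inl b, .inr c => eps a b c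
  | _, _, _ => 0

/-- The diagonal entries of the invariant form `Re tr`, up to a factor. -/
def sgn : Coord → ℤ
  | .inl _ => 1
  | .inr _ => -1

theorem sgn_mul_self : ∀ i, sgn i * sgn i = 1 := by decide

/-- The Cartan decomposition: the x-coordinates act by skew matrices (the compact part) and the
y-coordinates by symmetric ones. -/
theorem str_transpose : ∀ i j k, str i k j = -(sgn i * str i j k) := by decide +kernel

theorem str_antisymm : ∀ i j k, str i j k = -str j i k := by decide +kernel

/-- Invariance under the adjoint action of the form with diagonal entries `sgn`. -/
theorem sgn_mul_str : ∀ a j b, sgn b * str j b a = sgn a * str a j b := by decide +kernel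

/-- The Jacobi identity, in the shape in which the matrix of a commutator of linear fields appears.
-/
theorem str_jacobi : ∀ i j m k,
    ∑ n, (str j m n * str i n k - str i m n * str j n k) = ∑ l, str i j l * str l m k := by
  decide +kernel

/-- The hamiltonian vector field of a coordinate. -/
def ham (i : Coord) : Module.End ℝ (MvPowerSeries Coord ℝ) := linearField fun m k => (str i m k : ℝ)

theorem linearField_smul (r : ℝ) (A : Coord → Coord → ℝ) :
    linearField (fun m k => r * A m k) = r • linearField A := by
  simp only [linearField, Finset.smul_sum, mul_smul]

theorem linearField_sum (A : Coord → Coord → Coord → ℝ) :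
    linearField (fun m k => ∑ l, A l m k) = ∑ l, linearField (A l) := by
  simp only [linearField, Finset.sum_smul]
  conv_rhs => rw [Finset.sum_comm]
  refine Finset.sum_congr rfl fun m _ => ?_
  rw [Finset.sum_comm]

theorem ham_commutator (i j : Coord) :
    ham i * ham j - ham j * ham i = ∑ l, (str i j l : ℝ) • ham l := by
  rw [ham, ham, linearField_commutator]
  have : (fun m k => ∑ n, ((str j m n : ℝ) * str i n k - str i m n * str j n k)) =
      fun m k => ∑ l, (str i j l : ℝ) * str l m k := by
    ext m k
    exact_mod_cast congrArg (Int.cast (R := ℝ)) (str_jacobi i j m k)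
  rw [this, linearField_sum]
  simp only [linearField_smul, ham]

theorem preservesDegree_ham (i : Coord) : PreservesDegree (ham i) := preservesDegree_linearField _

theorem fischer_ham (n : ℕ) (i : Coord) (f g : MvPowerSeries Coord ℝ) :
    fischer n (ham i f) g = -(sgn i * fischer n f (ham i g)) := by
  have : linearField (fun m k => (str i k m : ℝ)) = (-(sgn i : ℝ)) • ham i := by
    rw [ham, ← linearField_smul]
    congr
    ext m k
    rw [str_transpose]
    push_cast
    ring
  have h := fischer_linearField n (fun m k => (str i m k : ℝ)) f g
  rw [this, LinearMap.smul_apply, fischer_comm n f, fischer_smul_left, fischer_comm n _ f] at h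
  exact h.trans (neg_mul _ _)

/-- The Casimir operator on coefficients. -/
def casimirEnd : Module.End ℝ (MvPowerSeries Coord ℝ) := ∑ a, (sgn a : ℝ) • (ham a * ham a)

/-- The sign in the adjoint of `ham a` cancels `sgn a`, so -Ω is the sum of the operators (ham
a)*(ham a). This is why the indefinite Casimir becomes semidefinite. -/
theorem fischer_casimirEnd (n : ℕ) (f g : MvPowerSeries Coord ℝ) :
    fischer n (casimirEnd f) g = -∑ a, fischer n (ham a f) (ham a g) := by
  simp only [casimirEnd, LinearMap.sum_apply, LinearMap.smul_apply, fischer_sum_left,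
    fischer_smul_left, Module.End.mul_apply, ← Finset.sum_neg_distrib]
  refine Finset.sum_congr rfl fun a _ => ?_
  rw [fischer_ham n a (ham a f)]
  have : (sgn a : ℝ) * sgn a = 1 := by exact_mod_cast sgn_mul_self a
  linear_combination (-fischer n (ham a f) (ham a g)) * this

theorem preservesDegree_casimirEnd : PreservesDegree casimirEnd := by
  intro n f hf
  simp only [casimirEnd, LinearMap.sum_apply, LinearMap.smul_apply, Module.End.mul_apply]
  exact Submodule.sum_mem _ fun a _ => Submodule.smul_mem _ _
    (preservesDegree_ham a n _ (preservesDegree_ham a n _ hf))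

/-- By self-adjointness ⟨Ωf, Ωf⟩ = ⟨Ω²f, f⟩ = 0, and the Fischer form is positive definite. -/
theorem casimirEnd_mem_vanishing (n : ℕ) (f : MvPowerSeries Coord ℝ)
    (h : casimirEnd (casimirEnd f) ∈ vanishing Coord n) : casimirEnd f ∈ vanishing Coord n := by
  refine mem_vanishing_of_fischer_self_eq_zero ?_
  have h1 := fischer_eq_zero_of_mem_vanishing h f
  rw [fischer_casimirEnd] at h1
  rw [fischer_casimirEnd, ← h1]
  simp only [fischer_comm n (ham _ f)]

/-- -⟨Ωf, f⟩ is the sum of the squared norms of the `ham a f`, so each of them vanishes. -/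
theorem ham_apply_eq_zero {f : MvPowerSeries Coord ℝ} (h : casimirEnd f = 0) (i : Coord) : ham i f = 0 := by
  refine eq_zero_of_forall_mem_vanishing fun n => mem_vanishing_of_fischer_self_eq_zero ?_
  have h1 := fischer_casimirEnd n f f
  rw [h, fischer_eq_zero_of_mem_vanishing (zero_mem _), eq_comm, neg_eq_zero] at h1
  exact (Finset.sum_eq_zero_iff_of_nonneg fun a _ => fischer_self_nonneg _ _).1 h1 i
    (Finset.mem_univ i)

/-- The Casimir element of a family of elements of an algebra with the commutation relations of
`𝔰𝔩₂(ℂ)` is central. -/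
theorem casimir_commute {A : Type*} [Ring A] [Algebra ℝ A] (e : Coord → A)
    (he : ∀ i j, e i * e j - e j * e i = ∑ l, (str i j l : ℝ) • e l) (j : Coord) :
    (∑ a, (sgn a : ℝ) • (e a * e a)) * e j = e j * ∑ a, (sgn a : ℝ) • (e a * e a) := by
  have h : (∑ a, (sgn a : ℝ) • (e a * e a)) * e j - e j * ∑ a, (sgn a : ℝ) • (e a * e a) =
      ∑ a, ∑ k, ((sgn a * str a j k : ℤ) : ℝ) • (e a * e k + e k * e a) := by
    simp only [Finset.sum_mul, Finset.mul_sum, ← Finset.sum_sub_distrib]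
    refine Finset.sum_congr rfl fun a _ => ?_
    have : e a * e a * e j - e j * (e a * e a) =
        e a * (e a * e j - e j * e a) + (e a * e j - e j * e a) * e a := by
      simp only [mul_sub, sub_mul, mul_assoc]
      abel
    rw [smul_mul_assoc, mul_smul_comm, ← smul_sub, this, he]
    simp only [Finset.mul_sum, Finset.sum_mul, ← Finset.sum_add_distrib, Finset.smul_sum,
      mul_smul_comm, smul_mul_assoc, ← smul_add, smul_smul, Int.cast_mul]
  -- The anticommutator is symmetric in a and k, while invariance of the form makes the coefficient
  -- antisymmetric, so the sum equals its own negative.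
  have h2 : ∑ a, ∑ k, ((sgn a * str a j k : ℤ) : ℝ) • (e a * e k + e k * e a) =
      -∑ a, ∑ k, ((sgn a * str a j k : ℤ) : ℝ) • (e a * e k + e k * e a) := by
    conv_lhs => rw [Finset.sum_comm]
    simp only [← Finset.sum_neg_distrib]
    refine Finset.sum_congr rfl fun a _ => Finset.sum_congr rfl fun k _ => ?_
    rw [add_comm (e k * e a), ← neg_smul]
    congr 1
    rw [← sgn_mul_str k j a, str_antisymm j a k]
    push_cast
    ring
  rw [← sub_eq_zero, h]
  have h3 := add_eq_zero_iff_eq_neg.2 h2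
  rw [← two_smul ℝ] at h3
  exact (smul_eq_zero.1 h3).resolve_left two_ne_zero

theorem casimirEnd_commute (j : Coord) : casimirEnd * ham j = ham j * casimirEnd :=
  casimir_commute ham ham_commutator j

theorem exists_casimir_pseudoInverse : ∃ T : Module.End ℝ (MvPowerSeries Coord ℝ),
    casimirEnd * (1 - casimirEnd * T) = 0 ∧ (∀ i, T * ham i = ham i * T) ∧
      T * casimirEnd = casimirEnd * T := by
  obtain ⟨T, h1, h2⟩ := exists_pseudoInverse casimirEnd preservesDegree_casimirEnd
    casimirEnd_mem_vanishing
  exact ⟨T, h1, fun i => h2 _ (preservesDegree_ham i) (casimirEnd_commute i),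
    h2 _ preservesDegree_casimirEnd rfl⟩

/-- An inverse of the Casimir operator on its range, which commutes with the hamiltonian vector
fields. -/
def casimirInv : Module.End ℝ (MvPowerSeries Coord ℝ) := exists_casimir_pseudoInverse.choose

/-- The projection onto the invariant series. -/
def invProj : Module.End ℝ (MvPowerSeries Coord ℝ) := 1 - casimirEnd * casimirInv

theorem casimirEnd_mul_invProj : casimirEnd * invProj = 0 := by
  rw [invProj, casimirInv]
  exact exists_casimir_pseudoInverse.choose_spec.1

theorem casimirInv_commute (i : Coord) : casimirInv * ham i = ham i * casimirInv :=
  exists_casimir_pseudoInverse.choose_spec.2.1 i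

theorem casimirInv_commute_casimirEnd : casimirInv * casimirEnd = casimirEnd * casimirInv :=
  exists_casimir_pseudoInverse.choose_spec.2.2

theorem invProj_mul_ham (i : Coord) : invProj * ham i = ham i * invProj := by
  rw [invProj, sub_mul, mul_sub, one_mul, mul_one, mul_assoc, casimirInv_commute, ← mul_assoc,
    casimirEnd_commute, mul_assoc]

theorem ham_mul_invProj (i : Coord) : ham i * invProj = 0 := by
  ext1 f
  have h := LinearMap.congr_fun casimirEnd_mul_invProj f
  rw [Module.End.mul_apply, LinearMap.zero_apply] at h
  rw [Module.End.mul_apply, LinearMap.zero_apply, ham_apply_eq_zero h]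

theorem invProj_apply_of_invariant {f : MvPowerSeries Coord ℝ} (h : ∀ i, ham i f = 0) : invProj f = f := by
  have hQ : casimirEnd f = 0 := by
    simp [casimirEnd, LinearMap.sum_apply, h]
  rw [invProj, ← casimirInv_commute_casimirEnd, LinearMap.sub_apply, Module.End.mul_apply, hQ]
  simp

attribute [irreducible] casimirEnd casimirInv invProj ham

end SL2C
end

/-! ### Homotopies: the abstract argument and the constant multivectors -/

noncomputable section

namespace SL2C

open FormalPoisson ExteriorModel

section AbstractHomotopy

variable {A : Type*} [Ring A] {e w k : Coord → A} {δ : A}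

variable [Algebra ℝ A]

/-- Anticommutator of the Chevalley–Eilenberg differential with the Casimir contraction. -/
theorem differential_casimir_homotopy
    (he : ∀ i j, e i * e j - e j * e i = ∑ l, (str i j l : ℝ) • e l)
    (hew : ∀ i j, w i * e j = e j * w i) (hek : ∀ i j, k i * e j = e j * k i)
    (heδ : ∀ j, δ * e j = e j * δ)
    (hkw : ∀ i j, k i * w j = (if i = j then 1 else 0) - w j * k i)
    (hδk : ∀ a, δ * k a + k a * δ = -∑ j, ∑ b, (str a j b : ℝ) • (w j * k b)) :
    (∑ i, e i * w i + δ) * (∑ a, (sgn a : ℝ) • (e a * k a)) +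
      (∑ a, (sgn a : ℝ) • (e a * k a)) * (∑ i, e i * w i + δ) =
        ∑ a, (sgn a : ℝ) • (e a * e a) := by
  -- The operators w_i and k_a anticommute up to a scalar. The remainder is the commutator of e_i
  -- and e_a, plus a diagonal term which will form the Casimir.
  have h1 (i a : Coord) : (e i * w i) * (e a * k a) + (e a * k a) * (e i * w i) =
      (∑ l, (str i a l : ℝ) • (e l * (w i * k a))) + if a = i then e a * e i else 0 := by
    have h2 : (e i * w i) * (e a * k a) = e i * e a * (w i * k a) := by
      rw [mul_assoc, ← mul_assoc (w i), hew]; simp only [mul_assoc]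
    have h3 : (e a * k a) * (e i * w i) = e a * e i * (k a * w i) := by
      rw [mul_assoc, ← mul_assoc (k a), hek]; simp only [mul_assoc]
    have h4 : ∑ l, (str i a l : ℝ) • (e l * (w i * k a)) =
        (e i * e a - e a * e i) * (w i * k a) := by
      simp only [he, Finset.sum_mul, smul_mul_assoc]
    rw [h2, h3, h4, hkw, mul_sub, sub_mul]
    split_ifs
    · rw [mul_one]; abel
    · rw [mul_zero]; abel
  have h5 : (∑ i, e i * w i) * (∑ a, (sgn a : ℝ) • (e a * k a)) +
      (∑ a, (sgn a : ℝ) • (e a * k a)) * (∑ i, e i * w i) =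
      (∑ a, ∑ j, ∑ b, ((sgn b * str j b a : ℤ) : ℝ) • (e a * (w j * k b))) +
        ∑ a, (sgn a : ℝ) • (e a * e a) := by
    have : (∑ i, e i * w i) * (∑ a, (sgn a : ℝ) • (e a * k a)) +
      (∑ a, (sgn a : ℝ) • (e a * k a)) * (∑ i, e i * w i) =
        ∑ i, ∑ a, (sgn a : ℝ) • ((e i * w i) * (e a * k a) + (e a * k a) * (e i * w i)) := by
      simp only [Finset.sum_mul_sum, mul_smul_comm, smul_mul_assoc, smul_add,
        Finset.sum_add_distrib]
      congr 1
      exact Finset.sum_comm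
    rw [this]
    simp only [h1, smul_add, Finset.sum_add_distrib, smul_ite, smul_zero, Finset.sum_ite_eq',
      Finset.mem_univ, if_true, Finset.smul_sum, smul_smul, Int.cast_mul]
    congr 1
    conv_rhs => rw [Finset.sum_comm]
    refine Finset.sum_congr rfl fun i _ => ?_
    rw [Finset.sum_comm]
  -- The bracket terms cancel against the Lie derivatives δk_a + k_aδ; the coefficients match by
  -- invariance of the form.
  have h6 : δ * (∑ a, (sgn a : ℝ) • (e a * k a)) + (∑ a, (sgn a : ℝ) • (e a * k a)) * δ =
      -∑ a, ∑ j, ∑ b, ((sgn b * str j b a : ℤ) : ℝ) • (e a * (w j * k b)) := by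
    have (a : Coord) : δ * (e a * k a) + (e a * k a) * δ = e a * (δ * k a + k a * δ) := by
      rw [← mul_assoc, heδ, mul_add, mul_assoc, mul_assoc]
    simp only [Finset.mul_sum, Finset.sum_mul, mul_smul_comm, smul_mul_assoc,
      ← Finset.sum_add_distrib, ← smul_add, this, hδk, mul_neg, smul_neg, Finset.sum_neg_distrib,
      Finset.smul_sum, smul_smul, sgn_mul_str, Int.cast_mul]
  rw [add_mul, mul_add, add_add_add_comm, h5, h6]
  abel

omit [Algebra ℝ A] in
/-- If the invariants split off, the complex retracts to the harmonic part of the invariants. -/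
theorem differential_homotopy {h Q T p σ q d : A}
    (hd : d = ∑ i, e i * w i + δ) (hdh : d * h + h * d = Q)
    (hT : ∀ i, T * e i = e i * T) (hTw : ∀ i, T * w i = w i * T) (hTδ : T * δ = δ * T)
    (hp : p = 1 - Q * T) (hpe : ∀ i, p * e i = 0) (hep : ∀ i, e i * p = 0)
    (hpw : ∀ i, p * w i = w i * p) (hpδ : p * δ = δ * p)
    (hpσ : p * σ = σ * p) (hσ : δ * σ + σ * δ = 1 - q) :
    d * (h * T + p * σ) + (h * T + p * σ) * d = 1 - p * q := by
  have h1 : T * d = d * T := by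
    simp only [hd, mul_add, add_mul, Finset.mul_sum, Finset.sum_mul, hTδ, ← mul_assoc, hT]
    simp only [mul_assoc, hTw]
  -- On invariants the e_i act as zero, so only δ is left of the differential.
  have h2 : d * p = p * δ := by
    have (i : Coord) : e i * w i * p = 0 := by rw [mul_assoc, ← hpw, ← mul_assoc, hep, zero_mul]
    simp only [hd, add_mul, Finset.sum_mul, this, hpδ, Finset.sum_const_zero, zero_add]
  have h3 : p * d = p * δ := by
    simp only [hd, mul_add, Finset.mul_sum, ← mul_assoc, hpe, zero_mul, Finset.sum_const_zero,
      zero_add]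
  -- The summand h T contributes QT = 1 - p, and p σ contributes p(1 - q).
  calc d * (h * T + p * σ) + (h * T + p * σ) * d
      = (d * h * T + h * (T * d)) + (d * p * σ + p * σ * d) := by noncomm_ring
    _ = (d * h + h * d) * T + (p * (δ * σ) + σ * (p * d)) := by
      rw [h1, h2, hpσ]; noncomm_ring
    _ = Q * T + p * (δ * σ + σ * δ) := by
      rw [h3, hdh, ← mul_assoc σ, ← hpσ, mul_add, mul_assoc p σ]
    _ = 1 - p * q := by rw [hσ, hp]; noncomm_ring

theorem sum_neg_intCast_smul (c : Coord → Coord → ℤ) (x : Coord → Coord → A) :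
    ∑ i, ∑ j, ((-c i j : ℤ) : ℝ) • x i j = -∑ i, ∑ j, (c i j : ℝ) • x i j := by
  simp only [Int.cast_neg, neg_smul, Finset.sum_neg_distrib]

theorem half_sum_neg_intCast_smul (c : Coord → Coord → Coord → ℤ) (x : Coord → Coord → Coord → A) :
    (1 / 2 : ℝ) • ∑ i, ∑ j, ∑ k, ((-c i j k : ℤ) : ℝ) • x i j k =
      (-1 / 2 : ℝ) • ∑ i, ∑ j, ∑ k, (c i j k : ℝ) • x i j k := by
  simp only [Int.cast_neg, neg_smul, Finset.sum_neg_distrib, smul_neg]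
  rw [neg_div, neg_smul]

end AbstractHomotopy


/-- The constant multivectors on `𝔰𝔩₂(ℂ)`. -/
abbrev Ext : Type := ExteriorAlgebra ℝ (Coord → ℝ)

/-- Exterior multiplication with a coordinate vector. -/
def wdg (a : Coord) : Module.End ℝ Ext :=
  LinearMap.mulLeft ℝ (ExteriorAlgebra.ι ℝ (Pi.single a (1 : ℝ)))

/-- Contraction with a coordinate covector. -/
def ctr (a : Coord) : Module.End ℝ Ext :=
  CliffordAlgebra.contractLeft (Q := (0 : QuadraticForm ℝ (Coord → ℝ))) (LinearMap.proj a)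

theorem ctr_mul_wdg (a b : Coord) :
    ctr a * wdg b = (if a = b then 1 else 0) - wdg b * ctr a := by
  refine LinearMap.ext fun x => ?_
  have := Tree.contractLeft_ι_mul (LinearMap.proj a) (Pi.single b (1 : ℝ) : Coord → ℝ) x
  simp only [LinearMap.proj_apply, Pi.single_apply] at this
  refine this.trans ?_
  split_ifs <;> simp [wdg, ctr]

/-- The position of a coordinate in the order `x₁, x₂, x₃, y₁, y₂, y₃`. -/
def num : Coord → ℕ
  | .inl j => j
  | .inr j => j + 3

/-- The coordinate at a given position. -/
def coordAt : ℕ → Coord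
  | 0 => .inl 0
  | 1 => .inl 1
  | 2 => .inl 2
  | 3 => .inr 0
  | 4 => .inr 1
  | _ => .inr 2

theorem coordAt_num : ∀ a, coordAt (num a) = a := by decide

theorem num_lt : ∀ a, num a < 6 := by decide

theorem coordAt_injOn : ∀ k < 6, ∀ j < 6, (coordAt k = coordAt j ↔ j = k) := by decide

/-- The generators of the exterior algebra, padded by zero. -/
def gen (k : ℕ) : Coord → ℝ := if k < 6 then Pi.single (coordAt k) 1 else 0

/-- The dual generators. -/
def dualGen (k : ℕ) : Module.Dual ℝ (Coord → ℝ) := LinearMap.proj (coordAt k)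

/-- The relation is required for every `j`; this is why the generators from index 6 on are zero. -/
theorem dualGen_gen : ∀ k < 6, ∀ j, dualGen k (gen j) = if j = k then 1 else 0 := by
  intro k hk j
  rw [dualGen, gen, LinearMap.proj_apply]
  by_cases hj : j < 6
  · rw [if_pos hj, Pi.single_apply]
    simp only [coordAt_injOn k hk j hj]
  · rw [if_neg hj, if_neg (by omega), Pi.zero_apply]

theorem span_gen : ⊤ ≤ Submodule.span ℝ {y | ∃ k < 6, y = gen k} := by
  rw [← (Pi.basisFun ℝ Coord).span_eq]
  refine Submodule.span_mono ?_
  rintro _ ⟨a, rfl⟩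
  exact ⟨num a, num_lt a, by simp [gen, num_lt, coordAt_num]⟩

/-- The endomorphism of the constant multivectors given by an expression. -/
def ev (p : Op) : Module.End ℝ Ext := p.eval gen dualGen

theorem ev_eq_of_check {p q : Op} (h : p.check 6 q = true) : ev p = ev q :=
  Op.eval_eq_of_check dualGen_gen span_gen h

theorem ev_wedge (a : Coord) : ev (.wedge (num a)) = wdg a := by
  simp [ev, Op.eval, wdg, gen, num_lt, coordAt_num]

theorem ev_contr (a : Coord) : ev (.contr (num a)) = ctr a := by
  simp [ev, Op.eval, ctr, dualGen, coordAt_num]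

theorem ev_one : ev .one = 1 := rfl
theorem ev_vac : ev .vac = Op.vacEnd := rfl
theorem ev_add (p q : Op) : ev (.add p q) = ev p + ev q := rfl
theorem ev_mul (p q : Op) : ev (.mul p q) = ev p * ev q := rfl
theorem ev_smul (z : ℤ) (p : Op) : ev (.smul z p) = (z : ℝ) • ev p := rfl

/-- The sum of a family of expressions indexed by the coordinates. -/
def sumOp (f : Coord → Op) : Op :=
  .add (.add (f (.inl 0)) (.add (f (.inl 1)) (f (.inl 2))))
    (.add (f (.inr 0)) (.add (f (.inr 1)) (f (.inr 2))))

theorem ev_sumOp (f : Coord → Op) : ev (sumOp f) = ∑ a, ev (f a) := by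
  simp only [sumOp, ev_add, Fintype.sum_sum_type, Fin.sum_univ_three]
  abel

/-- The Chevalley–Eilenberg differential on constant multivectors. -/
def delta : Module.End ℝ Ext := ev deltaOp

/-- The factor 2 arises because the full sum meets every bracket twice, once for each order of the
arguments. -/
theorem check_delta : (Op.smul 2 deltaOp).check 6 (sumOp fun i => sumOp fun j => sumOp fun k =>
    .smul (-str i j k) (.mul (.wedge (num i)) (.mul (.wedge (num j)) (.contr (num k))))) = true := by
  decide +kernel

theorem delta_eq : delta = (-1 / 2 : ℝ) • ∑ i, ∑ j, ∑ k, (str i j k : ℝ) •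
    (wdg i * (wdg j * ctr k)) := by
  have h := ev_eq_of_check check_delta
  simp only [ev_sumOp, ev_smul, ev_mul, ev_wedge, ev_contr] at h
  have h2 : delta = (1 / 2 : ℝ) • ((2 : ℤ) : ℝ) • ev deltaOp := by
    rw [smul_smul, delta]; norm_num
  rw [h2, h]
  exact half_sum_neg_intCast_smul str fun i j k => wdg i * (wdg j * ctr k)

theorem check_delta_contr : ∀ a, (Op.add (.mul deltaOp (.contr (num a)))
    (.mul (.contr (num a)) deltaOp)).check 6 (sumOp fun j => sumOp fun b =>
    .smul (-str a j b) (.mul (.wedge (num j)) (.contr (num b)))) = true := by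
  decide +kernel

/-- Cartan's formula: the anticommutator of δ with a contraction is the Lie derivative on constant
multivectors. -/
theorem delta_ctr (a : Coord) :
    delta * ctr a + ctr a * delta = -∑ j, ∑ b, (str a j b : ℝ) • (wdg j * ctr b) := by
  have h := ev_eq_of_check (check_delta_contr a)
  simp only [ev_sumOp, ev_smul, ev_mul, ev_wedge, ev_contr, ev_add] at h
  rw [delta, h]
  exact sum_neg_intCast_smul (str a) fun j b => wdg j * ctr b

/-- The Laplace operator on constant multivectors. -/
def laplace : Module.End ℝ Ext := delta * ev codeltaOp + ev codeltaOp * delta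

/-- The projection onto the invariant constant multivectors. -/
def harm : Module.End ℝ Ext := (1 / 16 : ℝ) • ev projOp

/-- A homotopy on the constant multivectors. -/
def cohom : Module.End ℝ Ext := (1 / 8 : ℝ) • (ev codeltaOp * (6 - laplace))

theorem delta_mul_delta : delta * delta = 0 := by
  have h := ev_eq_of_check check_delta_delta
  rw [ev_mul, ev_smul, Int.cast_zero, zero_smul] at h
  exact h

theorem delta_mul_harm : delta * harm = 0 := by
  have h := ev_eq_of_check check_delta_proj
  rw [ev_mul, ev_smul, Int.cast_zero, zero_smul] at h
  rw [harm, mul_smul_comm, delta, h, smul_zero]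

theorem harm_mul_delta : harm * delta = 0 := by
  have h := ev_eq_of_check check_proj_delta
  rw [ev_mul, ev_smul, Int.cast_zero, zero_smul] at h
  rw [harm, smul_mul_assoc, delta, h, smul_zero]

theorem laplace_polynomial : laplace * laplace - (6 : ℝ) • laplace + (8 : ℝ) • 1 = (8 : ℝ) • harm := by
  have h := ev_eq_of_check check_laplace
  have hl : ev laplaceOp = laplace := rfl
  simp only [ev_mul, ev_smul, ev_add, hl, ev_one] at h
  rw [harm, ← h]
  simp only [mul_smul_comm, smul_smul, mul_add, add_mul, smul_mul_assoc, mul_one, one_mul]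
  push_cast
  module

/-- As L commutes with δ, the anticommutator is L(6 - L)/8. The constants 6 and 8 are dictated by 1
- L(6 - L)/8 = (L - 2)(L - 4)/8 = q. -/
theorem delta_cohom : delta * cohom + cohom * delta = 1 - harm := by
  have h1 : laplace * delta = delta * laplace := by
    rw [laplace, add_mul, mul_add, mul_assoc, mul_assoc _ delta delta, delta_mul_delta, mul_zero,
      ← mul_assoc delta delta, delta_mul_delta, zero_mul, add_zero, zero_add]
  have h2 : delta * cohom + cohom * delta = (1 / 8 : ℝ) • (laplace * (6 - laplace)) := by
    have h3 : (6 - laplace) * delta = delta * (6 - laplace) := by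
      rw [sub_mul, mul_sub, h1]
      congr 1
      exact (Nat.cast_commute 6 delta).eq
    rw [cohom, mul_smul_comm, smul_mul_assoc, ← smul_add, mul_assoc (ev codeltaOp), h3,
      ← mul_assoc, ← mul_assoc, ← add_mul, ← laplace]
  have h4 : (6 : Module.End ℝ Ext) = (6 : ℝ) • 1 := by
    rw [← Algebra.algebraMap_eq_smul_one, map_ofNat]
  have h5 : (8 : ℝ) • harm = (8 : ℝ) • (1 - (1 / 8 : ℝ) • (laplace * (6 - laplace))) := by
    rw [← laplace_polynomial, h4, mul_sub, mul_smul_comm, mul_one]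
    module
  have h6 := smul_right_injective _ (by norm_num : (8 : ℝ) ≠ 0) h5
  rw [h2, h6, sub_sub_cancel]

attribute [irreducible] delta harm cohom laplace

end SL2C
end

/-! ### The Poisson differential and the Cartan forms in coordinates -/

noncomputable section

namespace SL2C

open FormalPoisson ExteriorModel

/-- Antisymmetry folds the two orders of each bracket together, leaving the cyclic triples (t + 1, t
+ 2, t). -/
theorem sum_str_smul {W : Type*} [AddCommGroup W] [Module ℝ W] (F : Coord → Coord → Coord → W)
    (hF : ∀ i j k, F j i k = -F i j k) :
    ∑ i, ∑ j, ∑ k, (str i j k : ℝ) • F i j k =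
      (2 : ℝ) • ∑ t : Fin 3, (F (.inl (t + 1)) (.inl (t + 2)) (.inl t) -
        F (.inr (t + 1)) (.inr (t + 2)) (.inl t) + F (.inl (t + 1)) (.inr (t + 2)) (.inr t) +
        F (.inr (t + 1)) (.inl (t + 2)) (.inr t)) := by
  simp [Fintype.sum_sum_type, Fin.sum_univ_three, str, eps]
  simp only [hF (.inl 1) (.inl 0), hF (.inl 2) (.inl 0), hF (.inl 2) (.inl 1),
    hF (.inr 1) (.inr 0), hF (.inr 2) (.inr 0), hF (.inr 2) (.inr 1), hF (.inl _) (.inr _)]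
  module

/-- Because the structure constants are antisymmetric, `-F j i k` contributes as much as `F i j k`,
which absorbs the factor 1/2. -/
theorem half_sum_str_smul {W : Type*} [AddCommGroup W] [Module ℝ W]
    (F G : Coord → Coord → Coord → W) :
    (1 / 2 : ℝ) • ∑ i, ∑ j, ∑ k, (str i j k : ℝ) • (F i j k - F j i k - G i j k) =
      ∑ i, ∑ j, ∑ k, (str i j k : ℝ) • F i j k +
        (-1 / 2 : ℝ) • ∑ i, ∑ j, ∑ k, (str i j k : ℝ) • G i j k := by
  have h : ∑ i, ∑ j, ∑ k, (str i j k : ℝ) • F j i k =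
      -∑ i, ∑ j, ∑ k, (str i j k : ℝ) • F i j k := by
    rw [Finset.sum_comm]
    simp only [← Finset.sum_neg_distrib, ← neg_smul]
    refine Finset.sum_congr rfl fun i _ => Finset.sum_congr rfl fun j _ =>
      Finset.sum_congr rfl fun k _ => ?_
    rw [str_antisymm j i k]
    push_cast
    rfl
  simp only [smul_sub, Finset.sum_sub_distrib, h]
  module

/-- The basis vector of the exterior algebra. -/
def ee (a : Coord) : Ext := ExteriorAlgebra.ι ℝ (Pi.single a (1 : ℝ))

theorem ee_mul_ee (a b : Coord) : ee a * ee b = -(ee b * ee a) :=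
  eq_neg_of_add_eq_zero_left (ExteriorAlgebra.ι_add_mul_swap _ _)

theorem dz_eq (j : Fin 3) : dz j =
    (const (1 / 2) : CSeries) ⊗ₜ[ℝ] ee (.inl j) - const (Complex.I / 2) ⊗ₜ[ℝ] ee (.inr j) := by
  rw [dz, coordField, coordField, smul_sub, TensorProduct.smul_tmul', TensorProduct.smul_tmul',
    TensorProduct.smul_tmul', ee, ee]
  simp only [smul_eq_mul, mul_one, const, ← map_mul]
  congr 3
  ring_nf

theorem reSeries_z_mul_const (c : Fin 3) (u : ℂ) : reSeries (z c * const u) =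
    u.re • MvPowerSeries.X (.inl c) - u.im • MvPowerSeries.X (.inr c) := by
  ext n
  change (MvPowerSeries.coeff n (z c * const u)).re = _
  have h (k : Coord) : (MvPowerSeries.coeff n (MvPowerSeries.X k : CSeries)) =
      ((MvPowerSeries.coeff n (MvPowerSeries.X k : RSeries) : ℝ) : ℂ) := by
    rw [MvPowerSeries.coeff_X, MvPowerSeries.coeff_X]
    split_ifs <;> simp
  simp only [z, const, add_mul, map_add, map_sub, map_smul, MvPowerSeries.coeff_mul_C,
    MvPowerSeries.coeff_C_mul, h, smul_eq_mul]
  simp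
  ring

theorem dz_mul_dz (a b : Fin 3) : dz a * dz b =
    (const (1 / 4) : CSeries) ⊗ₜ[ℝ] (ee (.inl a) * ee (.inl b)) +
      const (-1 / 4) ⊗ₜ[ℝ] (ee (.inr a) * ee (.inr b)) +
      const (-Complex.I / 4) ⊗ₜ[ℝ] (ee (.inl a) * ee (.inr b)) +
      const (-Complex.I / 4) ⊗ₜ[ℝ] (ee (.inr a) * ee (.inl b)) := by
  have h1 : (-1 / 4 : ℂ) = Complex.I / 2 * (Complex.I / 2) := by
    linear_combination (-1 / 4) * Complex.I_mul_I
  have h2 : (-Complex.I / 4 : ℂ) = -(1 / 2 * (Complex.I / 2)) := by ring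
  have h3 : (1 / 4 : ℂ) = 1 / 2 * (1 / 2) := by norm_num
  rw [dz_eq, dz_eq, h1, h2, h3]
  simp only [sub_mul, mul_sub, Algebra.TensorProduct.tmul_mul_tmul, const, map_mul, map_neg,
    TensorProduct.neg_tmul]
  rw [mul_comm (MvPowerSeries.C (Complex.I / 2)) (MvPowerSeries.C (1 / 2))]
  abel

theorem re_smul_dz_mul_dz (a b c : Fin 3) : (4 : ℝ) • rePart (z c • (dz a * dz b)) =
    (MvPowerSeries.X (.inl c) : RSeries) ⊗ₜ[ℝ] (ee (.inl a) * ee (.inl b)) -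
      (MvPowerSeries.X (.inl c) : RSeries) ⊗ₜ[ℝ] (ee (.inr a) * ee (.inr b)) +
      (MvPowerSeries.X (.inr c) : RSeries) ⊗ₜ[ℝ] (ee (.inl a) * ee (.inr b)) +
      (MvPowerSeries.X (.inr c) : RSeries) ⊗ₜ[ℝ] (ee (.inr a) * ee (.inl b)) := by
  rw [dz_mul_dz]
  simp only [smul_add, TensorProduct.smul_tmul', smul_eq_mul, map_add, rePart,
    LinearMap.rTensor_tmul, reSeries_z_mul_const]
  norm_num
  simp only [← TensorProduct.smul_tmul', smul_smul]
  norm_num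
  rw [sub_eq_add_neg]
  congr 1

/-- The Poisson structure in terms of structure constants. -/
theorem poisson_eq : poisson = (1 / 2 : ℝ) • ∑ i, ∑ j, ∑ k, (str i j k : ℝ) •
    ((MvPowerSeries.X k : RSeries) ⊗ₜ[ℝ] (ee i * ee j)) := by
  have h := sum_str_smul (fun i j k => (MvPowerSeries.X k : RSeries) ⊗ₜ[ℝ] (ee i * ee j))
    (fun i j k => by rw [ee_mul_ee, TensorProduct.tmul_neg])
  rw [h, smul_smul, poisson, piC]
  simp only [map_add, smul_add, re_smul_dz_mul_dz, Fin.sum_univ_three]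
  simp only [show (1 + 1 : Fin 3) = 2 from rfl, show (1 + 2 : Fin 3) = 0 from rfl,
    show (2 + 1 : Fin 3) = 0 from rfl, show (2 + 2 : Fin 3) = 1 from rfl, zero_add]
  norm_num

/-- The action on formal multivector fields of an operator on coefficients. -/
def onCoeff : Module.End ℝ (MvPowerSeries Coord ℝ) →ₐ[ℝ] Module.End ℝ (Multivector Coord ℝ) :=
  Module.End.rTensorAlgHom ℝ (MvPowerSeries Coord ℝ) Ext

/-- The action on formal multivector fields of an operator on constant multivectors. -/
def onExt : Module.End ℝ Ext →ₐ[ℝ] Module.End ℝ (Multivector Coord ℝ) :=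
  Module.End.lTensorAlgHom ℝ Ext (MvPowerSeries Coord ℝ)

theorem onCoeff_tmul (A : Module.End ℝ (MvPowerSeries Coord ℝ)) (f : MvPowerSeries Coord ℝ)
    (ω : Ext) : onCoeff A (f ⊗ₜ[ℝ] ω) = A f ⊗ₜ[ℝ] ω := rfl

theorem onExt_tmul (B : Module.End ℝ Ext) (f : MvPowerSeries Coord ℝ)
    (ω : Ext) : onExt B (f ⊗ₜ[ℝ] ω) = f ⊗ₜ[ℝ] B ω := rfl

theorem onExt_mul_onCoeff (B : Module.End ℝ Ext) (A : Module.End ℝ (MvPowerSeries Coord ℝ)) :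
    onExt B * onCoeff A = onCoeff A * onExt B :=
  TensorProduct.ext' fun f ω => by
    simp only [Module.End.mul_apply, onCoeff_tmul, onExt_tmul]

/-- The Schouten bracket as a linear function of its first argument. -/
def schoutenLeft (Q : Multivector Coord ℝ) : Multivector Coord ℝ →ₗ[ℝ] Multivector Coord ℝ :=
  ∑ b : Coord, (LinearMap.mulRight ℝ (coeffDeriv b Q) ∘ₗ contractR b -
    LinearMap.mulRight ℝ (contractL b Q) ∘ₗ coeffDeriv b)

theorem schouten_apply (P Q : Multivector Coord ℝ) : schouten P Q = schoutenLeft Q P := by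
  simp [schouten, schoutenLeft]

theorem contractR_tmul (b i j : Coord) (f : MvPowerSeries Coord ℝ) :
    contractR b (f ⊗ₜ[ℝ] (ee i * ee j)) =
      f ⊗ₜ[ℝ] ((Pi.single j (1 : ℝ) : Coord → ℝ) b • ee i -
        (Pi.single i (1 : ℝ) : Coord → ℝ) b • ee j) := by
  rw [contractR, LinearMap.lTensor_tmul]
  congr 1
  have h := CliffordAlgebra.contractRight_mul_ι (Q := (0 : QuadraticForm ℝ (Coord → ℝ)))
    (d := LinearMap.proj b) (Pi.single j (1 : ℝ)) (ee i)
  have h' := CliffordAlgebra.contractRight_ι (Q := (0 : QuadraticForm ℝ (Coord → ℝ)))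
    (d := LinearMap.proj b) (Pi.single i (1 : ℝ))
  refine h.trans ?_
  simp only [LinearMap.proj_apply]
  congr 1
  refine (congrArg (fun x : Ext => x * ee j) h').trans ?_
  exact (Algebra.smul_def _ _).symm

/-- Right contraction of e_i ∧ e_j with dx_b survives only for b = j and, with a minus sign, for b =
i; the derivative of x_k survives only for b = k. -/
theorem schouten_X_tmul (i j k : Coord) :
    schouten ((MvPowerSeries.X k : RSeries) ⊗ₜ[ℝ] (ee i * ee j)) =
      onCoeff (mulX k * partialD j) * onExt (wdg i) - onCoeff (mulX k * partialD i) * onExt (wdg j) -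
        onExt (wdg i * (wdg j * ctr k)) := by
  refine TensorProduct.ext' fun f ω => ?_
  have h1 (b : Coord) : coeffDeriv b (f ⊗ₜ[ℝ] ω) = (MvPowerSeries.pderiv ℝ b f) ⊗ₜ[ℝ] ω := rfl
  have h2 (b : Coord) : contractL b (f ⊗ₜ[ℝ] ω) = f ⊗ₜ[ℝ] ctr b ω := rfl
  have h3 (b : Coord) : coeffDeriv b ((MvPowerSeries.X k : RSeries) ⊗ₜ[ℝ] (ee i * ee j)) =
      (Pi.single k (1 : RSeries) : Coord → RSeries) b ⊗ₜ[ℝ] (ee i * ee j) := by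
    rw [coeffDeriv, LinearMap.rTensor_tmul]
    congr 1
    refine (MvPowerSeries.pderiv_X b k).trans ?_
    by_cases h : k = b
    · rw [h]
    · rw [Pi.single_eq_of_ne h, Pi.single_eq_of_ne (Ne.symm h)]
  simp only [schouten, LinearMap.sum_apply, LinearMap.sub_apply, LinearMap.comp_apply,
    LinearMap.mulLeft_apply, contractR_tmul, h1, h2, h3, Algebra.TensorProduct.tmul_mul_tmul,
    Finset.sum_sub_distrib, sub_mul, TensorProduct.tmul_sub,
    Pi.single_apply, ite_smul, one_smul, zero_smul, ite_mul, zero_mul, one_mul,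
    TensorProduct.tmul_ite, TensorProduct.ite_tmul, Finset.sum_ite_eq', Finset.mem_univ, if_true, mul_assoc (ee i)]
  rfl

/-- The first-order terms collect into the hamiltonian fields of the coordinates, and the terms that
differentiate the coefficients of π collect into δ. -/
theorem schouten_poisson :
    schouten poisson = ∑ i, onCoeff (ham i) * onExt (wdg i) + onExt delta := by
  have h0 : schouten poisson = (1 / 2 : ℝ) • ∑ i, ∑ j, ∑ k, (str i j k : ℝ) •
      schouten ((MvPowerSeries.X k : RSeries) ⊗ₜ[ℝ] (ee i * ee j)) := by
    refine LinearMap.ext fun Q => ?_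
    simp only [schouten_apply, poisson_eq, map_smul, map_sum, LinearMap.smul_apply,
      LinearMap.sum_apply]
  rw [h0, delta_eq]
  simp only [schouten_X_tmul]
  refine (half_sum_str_smul (fun i j k => onCoeff (mulX k * partialD j) * onExt (wdg i))
    (fun i j k => onExt (wdg i * (wdg j * ctr k)))).trans ?_
  congr 1
  · refine Finset.sum_congr rfl fun i _ => ?_
    rw [ham, linearField]
    simp only [map_sum, map_smul, Finset.sum_mul, smul_mul_assoc]
  · simp only [map_sum, map_smul]

theorem rePart_const (u : ℂ) (ω : Ext) :
    rePart (const u ⊗ₜ[ℝ] ω) = u.re • ((1 : RSeries) ⊗ₜ[ℝ] ω) := by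
  rw [rePart, LinearMap.rTensor_tmul, TensorProduct.smul_tmul']
  congr 1
  ext n
  change (MvPowerSeries.coeff n (const u)).re = _
  rw [const, MvPowerSeries.coeff_C, map_smul, MvPowerSeries.coeff_one]
  split_ifs <;> simp

theorem imPart_const (u : ℂ) (ω : Ext) :
    imPart (const u ⊗ₜ[ℝ] ω) = u.im • ((1 : RSeries) ⊗ₜ[ℝ] ω) := by
  rw [imPart, LinearMap.rTensor_tmul, TensorProduct.smul_tmul']
  congr 1
  ext n
  change (MvPowerSeries.coeff n (const u)).im = _
  rw [const, MvPowerSeries.coeff_C, map_smul, MvPowerSeries.coeff_one]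
  split_ifs <;> simp

theorem dz_mul_dz_mul_dz : dz 0 * dz 1 * dz 2 =
    const (1 / 8) ⊗ₜ[ℝ] (ee (.inl 0) * ee (.inl 1) * ee (.inl 2)) +
    const (-1 / 8) ⊗ₜ[ℝ] (ee (.inr 0) * ee (.inr 1) * ee (.inl 2)) +
    const (-1 / 8) ⊗ₜ[ℝ] (ee (.inl 0) * ee (.inr 1) * ee (.inr 2)) +
    const (-1 / 8) ⊗ₜ[ℝ] (ee (.inr 0) * ee (.inl 1) * ee (.inr 2)) +
    const (Complex.I / 8) ⊗ₜ[ℝ] (ee (.inr 0) * ee (.inr 1) * ee (.inr 2)) +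
    const (-Complex.I / 8) ⊗ₜ[ℝ] (ee (.inr 0) * ee (.inl 1) * ee (.inl 2)) +
    const (-Complex.I / 8) ⊗ₜ[ℝ] (ee (.inl 0) * ee (.inr 1) * ee (.inl 2)) +
    const (-Complex.I / 8) ⊗ₜ[ℝ] (ee (.inl 0) * ee (.inl 1) * ee (.inr 2)) := by
  have hI := Complex.I_mul_I
  have h1 : (1 / 8 : ℂ) = 1 / 4 * (1 / 2) := by norm_num
  have h2 : (-1 / 8 : ℂ) = -1 / 4 * (1 / 2) := by norm_num
  have h3 : (-1 / 8 : ℂ) = -(-Complex.I / 4 * (Complex.I / 2)) := by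
    linear_combination (-1 / 8) * hI
  have h4 : (Complex.I / 8 : ℂ) = -(-1 / 4 * (Complex.I / 2)) := by ring
  have h5 : (-Complex.I / 8 : ℂ) = -Complex.I / 4 * (1 / 2) := by ring
  have h6 : (-Complex.I / 8 : ℂ) = -(1 / 4 * (Complex.I / 2)) := by ring
  have hc (u v : ℂ) : (const u * const v : CSeries) = const (u * v) := (map_mul _ _ _).symm
  have hn (u : ℂ) (ω : Ext) : const (-u) ⊗ₜ[ℝ] ω = -((const u : CSeries) ⊗ₜ[ℝ] ω) := by
    rw [← TensorProduct.neg_tmul]; congr 1; exact map_neg _ _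
  rw [dz_mul_dz, dz_eq]
  simp only [add_mul, mul_sub, Algebra.TensorProduct.tmul_mul_tmul, hc]
  have k3 (ω : Ext) : const (-Complex.I / 4 * (Complex.I / 2)) ⊗ₜ[ℝ] ω =
      -((const (-1 / 8) : CSeries) ⊗ₜ[ℝ] ω) := by rw [h3, hn, neg_neg]
  have k4 (ω : Ext) : const (-1 / 4 * (Complex.I / 2)) ⊗ₜ[ℝ] ω =
      -((const (Complex.I / 8) : CSeries) ⊗ₜ[ℝ] ω) := by rw [h4, hn, neg_neg]
  have k6 (ω : Ext) : const (1 / 4 * (Complex.I / 2)) ⊗ₜ[ℝ] ω =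
      -((const (-Complex.I / 8) : CSeries) ⊗ₜ[ℝ] ω) := by rw [h6, hn, neg_neg]
  simp only [← h1, ← h2, ← h5, k3, k4, k6]
  abel

/-- The constant three-vector `C_R`. -/
def cR : Ext := (1 / 2 : ℝ) • (ee (.inl 0) * ee (.inl 1) * ee (.inl 2) -
  ee (.inr 0) * ee (.inr 1) * ee (.inl 2) - ee (.inl 0) * ee (.inr 1) * ee (.inr 2) -
  ee (.inr 0) * ee (.inl 1) * ee (.inr 2))

/-- The constant three-vector `C_I`. -/
def cI : Ext := (1 / 2 : ℝ) • (ee (.inr 0) * ee (.inr 1) * ee (.inr 2) -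
  ee (.inr 0) * ee (.inl 1) * ee (.inl 2) - ee (.inl 0) * ee (.inr 1) * ee (.inl 2) -
  ee (.inl 0) * ee (.inl 1) * ee (.inr 2))

theorem CR_eq : CR = (1 : RSeries) ⊗ₜ[ℝ] cR := by
  rw [CR, cartan, dz_mul_dz_mul_dz, cR]
  simp only [map_smul, map_add, rePart_const, TensorProduct.tmul_smul, TensorProduct.tmul_sub]
  norm_num
  module

theorem CI_eq : CI = (1 : RSeries) ⊗ₜ[ℝ] cI := by
  rw [CI, cartan, dz_mul_dz_mul_dz, cI]
  simp only [map_smul, map_add, imPart_const, TensorProduct.tmul_smul, TensorProduct.tmul_sub]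
  norm_num
  module

theorem dx_eq (j : Fin 3) : dx j = (1 : RSeries) ⊗ₜ[ℝ] ee (.inl j) := rfl

theorem dy_eq (j : Fin 3) : dy j = (1 : RSeries) ⊗ₜ[ℝ] ee (.inr j) := rfl

theorem CR_explicit : CR = (1 / 2 : ℝ) • (dx 0 * dx 1 * dx 2 - dy 0 * dy 1 * dx 2
      - dx 0 * dy 1 * dy 2 - dy 0 * dx 1 * dy 2) := by
  rw [CR_eq, cR]
  simp only [dx_eq, dy_eq, Algebra.TensorProduct.tmul_mul_tmul, mul_one, TensorProduct.tmul_smul,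
    TensorProduct.tmul_sub]

theorem CI_explicit : CI = (1 / 2 : ℝ) • (dy 0 * dy 1 * dy 2 - dy 0 * dx 1 * dx 2
      - dx 0 * dy 1 * dx 2 - dx 0 * dx 1 * dy 2) := by
  rw [CI_eq, cI]
  simp only [dx_eq, dy_eq, Algebra.TensorProduct.tmul_mul_tmul, mul_one, TensorProduct.tmul_smul,
    TensorProduct.tmul_sub]

end SL2C
end

/-! ### Degrees and the coefficient functionals of the invariants -/

noncomputable section

namespace SL2C

open FormalPoisson ExteriorModel

/-- The constant multivectors of a given degree, zero in negative degrees. -/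
def gr (k : ℤ) : Submodule ℝ Ext := if 0 ≤ k then ⋀[ℝ]^k.toNat (Coord → ℝ) else ⊥

theorem gr_natCast (k : ℕ) : gr k = ⋀[ℝ]^k (Coord → ℝ) := by simp [gr]

theorem gr_of_neg {k : ℤ} (h : k < 0) : gr k = ⊥ := if_neg (by omega)

/-- The operator raises degrees by `m`. -/
def IsDeg (m : ℤ) (A : Module.End ℝ Ext) : Prop := ∀ k, ∀ x ∈ gr k, A x ∈ gr (k + m)

theorem IsDeg.add {m : ℤ} {A B : Module.End ℝ Ext} (hA : IsDeg m A) (hB : IsDeg m B) :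
    IsDeg m (A + B) := fun k x hx => add_mem (hA k x hx) (hB k x hx)

theorem IsDeg.sub {m : ℤ} {A B : Module.End ℝ Ext} (hA : IsDeg m A) (hB : IsDeg m B) :
    IsDeg m (A - B) := fun k x hx => sub_mem (hA k x hx) (hB k x hx)

theorem IsDeg.smul {m : ℤ} {A : Module.End ℝ Ext} (r : ℝ) (hA : IsDeg m A) :
    IsDeg m (r • A) := fun k x hx => Submodule.smul_mem _ r (hA k x hx)

theorem IsDeg.mul {m n : ℤ} {A B : Module.End ℝ Ext} (hA : IsDeg m A) (hB : IsDeg n B) :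
    IsDeg (m + n) (A * B) := fun k x hx => by
  have := hA _ _ (hB k x hx)
  rwa [add_assoc, add_comm n] at this

theorem isDeg_one : IsDeg 0 1 := fun k x hx => by simpa using hx

theorem isDeg_mulLeft (v : Coord → ℝ) : IsDeg 1 (LinearMap.mulLeft ℝ (ExteriorAlgebra.ι ℝ v)) := by
  intro k x hx
  rcases lt_or_ge k 0 with hk | hk
  · rw [gr_of_neg hk, Submodule.mem_bot] at hx
    rw [hx, map_zero]
    exact zero_mem _
  · lift k to ℕ using hk
    rw [gr_natCast] at hx
    rw [show (k : ℤ) + 1 = ((k + 1 : ℕ) : ℤ) by push_cast; rfl, gr_natCast,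
      ExteriorAlgebra.exteriorPower, pow_succ']
    exact Submodule.mul_mem_mul (LinearMap.mem_range_self _ _) hx

/-- Induction on the degree by the Leibniz rule; scalars are annihilated, in accordance with the
zero space in degree -1. -/
theorem isDeg_contractLeft (d : Module.Dual ℝ (Coord → ℝ)) :
    IsDeg (-1) (CliffordAlgebra.contractLeft (Q := (0 : QuadraticForm ℝ (Coord → ℝ))) d) := by
  intro k x hx
  rcases lt_or_ge k 0 with hk | hk
  · rw [gr_of_neg hk, Submodule.mem_bot] at hx
    rw [hx, map_zero]
    exact zero_mem _
  · lift k to ℕ using hk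
    induction k generalizing x with
    | zero =>
      rw [gr_natCast, ExteriorAlgebra.exteriorPower, pow_zero, Submodule.mem_one] at hx
      obtain ⟨r, rfl⟩ := hx
      rw [Tree.contractLeft_algebraMap]
      exact zero_mem _
    | succ k ih =>
      rw [gr_natCast, ExteriorAlgebra.exteriorPower, pow_succ'] at hx
      rw [show ((k + 1 : ℕ) : ℤ) + -1 = k by push_cast; ring]
      induction hx using Submodule.mul_induction_on' with
      | mem_mul_mem y hy z hz =>
        obtain ⟨v, rfl⟩ := hy
        rw [Tree.contractLeft_ι_mul]
        have hz' : z ∈ gr k := by rw [gr_natCast]; exact hz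
        refine sub_mem (Submodule.smul_mem _ _ hz') ?_
        have := isDeg_mulLeft v _ _ (ih z hz')
        rwa [neg_add_cancel_right] at this
      | add y _ z _ h1 h2 => rw [map_add]; exact add_mem h1 h2

/-- The projection to the scalars. -/
def vacFun : Ext →ₗ[ℝ] ℝ := (ExteriorAlgebra.algebraMapInv (R := ℝ) (M := Coord → ℝ)).toLinearMap

theorem vacFun_eq_zero {k : ℤ} (hk : k ≠ 0) {x : Ext} (hx : x ∈ gr k) : vacFun x = 0 := by
  rcases lt_or_ge k 0 with h | h
  · rw [gr_of_neg h, Submodule.mem_bot] at hx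
    rw [hx, map_zero]
  · lift k to ℕ using h
    obtain ⟨k, rfl⟩ := Nat.exists_eq_succ_of_ne_zero (by exact_mod_cast hk : k ≠ 0)
    rw [gr_natCast, ExteriorAlgebra.exteriorPower, pow_succ'] at hx
    induction hx using Submodule.mul_induction_on' with
    | mem_mul_mem y hy z hz =>
      obtain ⟨v, rfl⟩ := hy
      exact Tree.algebraMapInv_ι_mul _ _
    | add y _ z _ h1 h2 => rw [map_add, h1, h2, add_zero]

theorem vacEnd_apply (x : Ext) : (Op.vacEnd : Module.End ℝ Ext) x = vacFun x • 1 :=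
  Algebra.algebraMap_eq_smul_one (R := ℝ) (A := Ext) (vacFun x)

theorem isDeg_vacEnd : IsDeg 0 Op.vacEnd := by
  intro k x hx
  rw [vacEnd_apply]
  by_cases hk : k = 0
  · subst hk
    refine Submodule.smul_mem _ _ ?_
    have := gr_natCast 0
    rw [Nat.cast_zero] at this
    rw [add_zero, this, ExteriorAlgebra.exteriorPower, pow_zero]
    exact Submodule.one_le.1 le_rfl
  · rw [vacFun_eq_zero hk hx, zero_smul]
    exact zero_mem _

/-- The degree of a homogeneous expression. -/
def opDeg : Op → ℤ
  | .one => 0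
  | .vac => 0
  | .wedge _ => 1
  | .contr _ => -1
  | .add p _ => opDeg p
  | .mul p q => opDeg p + opDeg q
  | .smul _ p => opDeg p

/-- The expression is homogeneous. -/
def opHomogeneous : Op → Bool
  | .one => true
  | .vac => true
  | .wedge _ => true
  | .contr _ => true
  | .add p q => opHomogeneous p && opHomogeneous q && decide (opDeg p = opDeg q)
  | .mul p q => opHomogeneous p && opHomogeneous q
  | .smul _ p => opHomogeneous p

theorem isDeg_ev (p : Op) (h : opHomogeneous p = true) : IsDeg (opDeg p) (ev p) := by
  induction p with
  | one => exact isDeg_one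
  | vac => exact isDeg_vacEnd
  | wedge k => exact isDeg_mulLeft _
  | contr k => exact isDeg_contractLeft _
  | add p q hp hq =>
    simp only [opHomogeneous, Bool.and_eq_true, decide_eq_true_eq] at h
    exact (hp h.1.1).add (by
      have hd : opDeg p = opDeg q := h.2
      exact (hd ▸ hq h.1.2 : IsDeg (opDeg p) (ev q)))
  | mul p q hp hq =>
    simp only [opHomogeneous, Bool.and_eq_true] at h
    exact (hp h.1).mul (hq h.2)
  | smul z p hp => exact (hp h).smul _

theorem isDeg_delta : IsDeg 1 delta := by
  rw [delta]; exact isDeg_ev deltaOp (by decide)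

theorem isDeg_ctr (a : Coord) : IsDeg (-1) (ctr a) := isDeg_contractLeft _

theorem isDeg_cohom : IsDeg (-1) cohom := by
  have hk : IsDeg (-1) (ev codeltaOp) := isDeg_ev codeltaOp (by decide)
  have hl : IsDeg 0 laplace := by
    rw [laplace]
    exact (isDeg_delta.mul hk).add (hk.mul isDeg_delta)
  have h6 : IsDeg 0 (6 : Module.End ℝ Ext) := by
    have h4 : (6 : Module.End ℝ Ext) = (6 : ℝ) • 1 := by
      rw [← Algebra.algebraMap_eq_smul_one, map_ofNat]
    rw [h4]
    exact isDeg_one.smul _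
  rw [cohom]
  exact (hk.mul (h6.sub hl)).smul _

/-- The coefficient functional of `C_R`. -/
def cRFun : Ext →ₗ[ℝ] ℝ := (1 / 2 : ℝ) • vacFun ∘ₗ ev crDualOp

/-- The coefficient functional of `C_I`. -/
def cIFun : Ext →ₗ[ℝ] ℝ := (1 / 2 : ℝ) • vacFun ∘ₗ ev ciDualOp

/-- The coefficient functional of `C_R ∧ C_I`. -/
def topFun : Ext →ₗ[ℝ] ℝ := (1 / 4 : ℝ) • vacFun ∘ₗ ev topDualOp

theorem ev_wedge_coord : ev (.wedge 0) = wdg (.inl 0) ∧ ev (.wedge 1) = wdg (.inl 1) ∧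
    ev (.wedge 2) = wdg (.inl 2) ∧ ev (.wedge 3) = wdg (.inr 0) ∧ ev (.wedge 4) = wdg (.inr 1) ∧
    ev (.wedge 5) = wdg (.inr 2) :=
  ⟨ev_wedge (.inl 0), ev_wedge (.inl 1), ev_wedge (.inl 2), ev_wedge (.inr 0), ev_wedge (.inr 1),
    ev_wedge (.inr 2)⟩

theorem wdg_apply (a : Coord) (x : Ext) : wdg a x = ee a * x := rfl

theorem ev_crOp (x : Ext) : ev crOp x = (2 : ℝ) • (cR * x) := by
  obtain ⟨h0, h1, h2, h3, h4, h5⟩ := ev_wedge_coord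
  simp only [crOp, ev_add, ev_mul, ev_smul, h0, h1, h2, h3, h4, h5, LinearMap.add_apply,
    LinearMap.smul_apply, Module.End.mul_apply, wdg_apply, cR, smul_mul_assoc, sub_mul, mul_assoc]
  push_cast
  module

theorem ev_ciOp (x : Ext) : ev ciOp x = (2 : ℝ) • (cI * x) := by
  obtain ⟨h0, h1, h2, h3, h4, h5⟩ := ev_wedge_coord
  simp only [ciOp, ev_add, ev_mul, ev_smul, h0, h1, h2, h3, h4, h5, LinearMap.add_apply,
    LinearMap.smul_apply, Module.End.mul_apply, wdg_apply, cI, smul_mul_assoc, sub_mul, mul_assoc]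
  push_cast
  module

/-- The factors 16, 4, 4, 1 in `projOp`, divided by 16, compensate the normalising halves in `cR`,
`cI` and in the functionals. -/
theorem harm_apply (x : Ext) :
    harm x = vacFun x • 1 + cRFun x • cR + cIFun x • cI + topFun x • (cR * cI) := by
  simp only [harm, projOp, ev_add, ev_mul, ev_smul, ev_vac, LinearMap.add_apply,
    LinearMap.smul_apply, Module.End.mul_apply, vacEnd_apply, map_smul, ev_crOp, ev_ciOp, mul_one,
    cRFun, cIFun, topFun, LinearMap.comp_apply]
  push_cast
  module

theorem vacFun_ev_one (p : Op) (h : p.bounded 6 = true) :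
    vacFun (ev p 1) = ((p.apply (.leaf 1)).vac : ℝ) := by
  have h1 : (1 : Ext) = Tree.real gen (.leaf 1) := by simp [Tree.real]
  rw [h1, ev, Op.eval_real dualGen_gen p h]
  exact Tree.algebraMapInv_real _ _

theorem cR_eq_ev : cR = (1 / 2 : ℝ) • ev crOp 1 := by rw [ev_crOp, mul_one]; module

theorem cI_eq_ev : cI = (1 / 2 : ℝ) • ev ciOp 1 := by rw [ev_ciOp, mul_one]; module

theorem cR_mul_cI_eq_ev : cR * cI = (1 / 4 : ℝ) • ev (.mul crOp ciOp) 1 := by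
  rw [ev_mul, Module.End.mul_apply, ev_crOp, ev_ciOp, mul_one, mul_smul_comm]; module

theorem vacFun_ev_ev (p q : Op) (h : (Op.mul p q).bounded 6 = true) :
    vacFun (ev p (ev q 1)) = (((Op.mul p q).apply (.leaf 1)).vac : ℝ) :=
  vacFun_ev_one (.mul p q) h

theorem vacFun_one : vacFun 1 = 1 := map_one (ExteriorAlgebra.algebraMapInv (R := ℝ) (M := Coord → ℝ))

theorem cRFun_cR : cRFun cR = 1 := by
  rw [cR_eq_ev, cRFun, LinearMap.smul_apply, LinearMap.comp_apply, map_smul, map_smul,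
    vacFun_ev_ev _ _ (by decide), show ((Op.mul crDualOp crOp).apply (.leaf 1)).vac = 4 by
      decide +kernel]
  norm_num

theorem cRFun_cI : cRFun cI = 0 := by
  rw [cI_eq_ev, cRFun, LinearMap.smul_apply, LinearMap.comp_apply, map_smul, map_smul,
    vacFun_ev_ev _ _ (by decide), show ((Op.mul crDualOp ciOp).apply (.leaf 1)).vac = 0 by
      decide +kernel]
  norm_num

theorem cIFun_cR : cIFun cR = 0 := by
  rw [cR_eq_ev, cIFun, LinearMap.smul_apply, LinearMap.comp_apply, map_smul, map_smul,
    vacFun_ev_ev _ _ (by decide), show ((Op.mul ciDualOp crOp).apply (.leaf 1)).vac = 0 by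
      decide +kernel]
  norm_num

theorem cIFun_cI : cIFun cI = 1 := by
  rw [cI_eq_ev, cIFun, LinearMap.smul_apply, LinearMap.comp_apply, map_smul, map_smul,
    vacFun_ev_ev _ _ (by decide), show ((Op.mul ciDualOp ciOp).apply (.leaf 1)).vac = 4 by
      decide +kernel]
  norm_num

theorem topFun_top : topFun (cR * cI) = 1 := by
  rw [cR_mul_cI_eq_ev, topFun, LinearMap.smul_apply, LinearMap.comp_apply, map_smul, map_smul,
    vacFun_ev_ev _ _ (by decide),
    show ((Op.mul topDualOp (.mul crOp ciOp)).apply (.leaf 1)).vac = 16 by decide +kernel]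
  norm_num

theorem one_mem_gr : (1 : Ext) ∈ gr 0 := by
  have := gr_natCast 0
  rw [Nat.cast_zero] at this
  rw [this, ExteriorAlgebra.exteriorPower, pow_zero]
  exact Submodule.one_le.1 le_rfl

theorem cR_mem_gr : cR ∈ gr 3 := by
  rw [cR_eq_ev]
  exact Submodule.smul_mem _ _ (isDeg_ev crOp (by decide) 0 1 one_mem_gr)

theorem cI_mem_gr : cI ∈ gr 3 := by
  rw [cI_eq_ev]
  exact Submodule.smul_mem _ _ (isDeg_ev ciOp (by decide) 0 1 one_mem_gr)

theorem cR_mul_cI_mem_gr : cR * cI ∈ gr 6 := by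
  rw [cR_mul_cI_eq_ev]
  exact Submodule.smul_mem _ _ (isDeg_ev (.mul crOp ciOp) (by decide) 0 1 one_mem_gr)

theorem cRFun_eq_zero {k : ℤ} (hk : k ≠ 3) {x : Ext} (hx : x ∈ gr k) : cRFun x = 0 := by
  rw [cRFun, LinearMap.smul_apply, LinearMap.comp_apply,
    vacFun_eq_zero (k := k + -3) (by omega) (isDeg_ev crDualOp (by decide) k x hx), smul_zero]

theorem cIFun_eq_zero {k : ℤ} (hk : k ≠ 3) {x : Ext} (hx : x ∈ gr k) : cIFun x = 0 := by
  rw [cIFun, LinearMap.smul_apply, LinearMap.comp_apply,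
    vacFun_eq_zero (k := k + -3) (by omega) (isDeg_ev ciDualOp (by decide) k x hx), smul_zero]

theorem topFun_eq_zero {k : ℤ} (hk : k ≠ 6) {x : Ext} (hx : x ∈ gr k) : topFun x = 0 := by
  rw [topFun, LinearMap.smul_apply, LinearMap.comp_apply,
    vacFun_eq_zero (k := k + -6) (by omega) (isDeg_ev topDualOp (by decide) k x hx), smul_zero]

end SL2C
end

/-! ### Retraction of the complex onto its harmonic part -/

noncomputable section

namespace SL2C

open FormalPoisson ExteriorModel

/-- The homotopy which contracts the complex to its harmonic part. -/
def homotopy : Module.End ℝ (Multivector Coord ℝ) :=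
  (∑ a, (sgn a : ℝ) • (onCoeff (ham a) * onExt (ctr a))) * onCoeff casimirInv +
    onCoeff invProj * onExt cohom

/-- The projection to the harmonic part of the complex. -/
def harmonic : Module.End ℝ (Multivector Coord ℝ) := onCoeff invProj * onExt harm

theorem schouten_casimir_homotopy :
    schouten poisson * (∑ a, (sgn a : ℝ) • (onCoeff (ham a) * onExt (ctr a))) +
      (∑ a, (sgn a : ℝ) • (onCoeff (ham a) * onExt (ctr a))) * schouten poisson =
        onCoeff casimirEnd := by
  rw [schouten_poisson]
  refine (differential_casimir_homotopy (e := fun i => onCoeff (ham i))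
    (w := fun i => onExt (wdg i)) (k := fun i => onExt (ctr i)) (δ := onExt delta)
    (fun i j => ?_) (fun i j => onExt_mul_onCoeff _ _) (fun i j => onExt_mul_onCoeff _ _)
    (fun j => onExt_mul_onCoeff _ _) (fun i j => ?_) (fun a => ?_)).trans ?_
  · rw [← map_mul, ← map_mul]
    refine (map_sub onCoeff (ham i * ham j) (ham j * ham i)).symm.trans
      ((congrArg onCoeff (ham_commutator i j)).trans ?_)
    simp only [map_sum, map_smul]
  · rw [← map_mul, ctr_mul_wdg, map_sub, map_mul]
    split_ifs
    · rw [map_one]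
    · rw [map_zero]
  · rw [← map_mul, ← map_mul, ← map_add, delta_ctr, map_neg, map_sum]
    simp only [map_sum, map_smul, map_mul]
  · rw [casimirEnd, map_sum]
    simp only [map_smul, map_mul]

theorem schouten_homotopy :
    schouten poisson * homotopy + homotopy * schouten poisson = 1 - harmonic := by
  refine differential_homotopy (Q := onCoeff casimirEnd) (T := onCoeff casimirInv)
    (e := fun i => onCoeff (ham i)) (w := fun i => onExt (wdg i)) (δ := onExt delta)
    (p := onCoeff invProj) (σ := onExt cohom) (q := onExt harm)
    schouten_poisson schouten_casimir_homotopy (fun i => ?_)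
    (fun i => (onExt_mul_onCoeff _ _).symm) (onExt_mul_onCoeff _ _).symm ?_ (fun i => ?_)
    (fun i => ?_) (fun i => (onExt_mul_onCoeff _ _).symm) (onExt_mul_onCoeff _ _).symm
    (onExt_mul_onCoeff _ _).symm ?_
  · rw [← map_mul, casimirInv_commute, map_mul]
  · rw [invProj, map_sub, map_one, map_mul]
  · rw [← map_mul, invProj_mul_ham, ham_mul_invProj, map_zero]
  · rw [← map_mul, ham_mul_invProj, map_zero]
  · rw [← map_mul, ← map_mul, ← map_add, delta_cohom, map_sub, map_one]

/-- This makes harmonic fields cocycles; the product in the other order, treated next, shows that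
coboundaries have no harmonic part. So cohomology is the harmonic part itself. -/
theorem schouten_mul_harmonic : schouten poisson * harmonic = 0 := by
  rw [schouten_poisson, harmonic, add_mul, Finset.sum_mul]
  have h1 (i : Coord) :
      onCoeff (ham i) * onExt (wdg i) * (onCoeff invProj * onExt harm) = 0 := by
    rw [mul_assoc, ← mul_assoc (onExt (wdg i)), onExt_mul_onCoeff, mul_assoc, ← mul_assoc,
      ← map_mul, ham_mul_invProj, map_zero, zero_mul]
  rw [Finset.sum_eq_zero fun i _ => h1 i, ← mul_assoc, onExt_mul_onCoeff, mul_assoc, ← map_mul,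
    delta_mul_harm, map_zero, mul_zero, add_zero]

theorem harmonic_mul_schouten : harmonic * schouten poisson = 0 := by
  rw [schouten_poisson, harmonic, mul_add, Finset.mul_sum]
  have h1 (i : Coord) :
      onCoeff invProj * onExt harm * (onCoeff (ham i) * onExt (wdg i)) = 0 := by
    rw [mul_assoc, ← mul_assoc (onExt harm), onExt_mul_onCoeff, mul_assoc, ← mul_assoc,
      ← map_mul, invProj_mul_ham, ham_mul_invProj, map_zero, zero_mul]
  rw [Finset.sum_eq_zero fun i _ => h1 i, mul_assoc, ← map_mul,
    harm_mul_delta, map_zero, mul_zero, add_zero]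

/-- The formal multivector fields of a given degree, zero in negative degrees. -/
def fieldGr (k : ℤ) : Submodule ℝ (Multivector Coord ℝ) :=
  LinearMap.range (LinearMap.lTensor (MvPowerSeries Coord ℝ) (gr k).subtype)

theorem fieldGr_natCast (k : ℕ) : fieldGr k = degreePart Coord ℝ k := by
  rw [fieldGr, gr_natCast, degreePart]

theorem tmul_mem_fieldGr {k : ℤ} (f : MvPowerSeries Coord ℝ) {x : Ext} (hx : x ∈ gr k) :
    f ⊗ₜ[ℝ] x ∈ fieldGr k :=
  ⟨f ⊗ₜ[ℝ] ⟨x, hx⟩, rfl⟩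

theorem fieldGr_le {k : ℤ} {S : Submodule ℝ (Multivector Coord ℝ)}
    (h : ∀ (f : MvPowerSeries Coord ℝ), ∀ x ∈ gr k, f ⊗ₜ[ℝ] x ∈ S) : fieldGr k ≤ S := by
  rintro _ ⟨u, rfl⟩
  induction u with
  | zero => rw [map_zero]; exact zero_mem _
  | tmul f x => exact h f x.1 x.2
  | add u v hu hv => rw [map_add]; exact add_mem hu hv

theorem fieldGr_of_neg {k : ℤ} (hk : k < 0) : fieldGr k = ⊥ :=
  eq_bot_iff.2 <| fieldGr_le fun f x hx => by
    rw [gr_of_neg hk, Submodule.mem_bot] at hx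
    rw [hx, TensorProduct.tmul_zero]
    exact zero_mem _

theorem onCoeff_mul_onExt_mem {k m : ℤ} (A : Module.End ℝ (MvPowerSeries Coord ℝ))
    {B : Module.End ℝ Ext} (hB : IsDeg m B) {P : Multivector Coord ℝ} (hP : P ∈ fieldGr k) :
    (onCoeff A * onExt B) P ∈ fieldGr (k + m) :=
  fieldGr_le (S := (fieldGr (k + m)).comap (onCoeff A * onExt B))
    (fun _ x hx => tmul_mem_fieldGr _ (hB k x hx)) hP

theorem homotopy_mem {k : ℤ} {P : Multivector Coord ℝ} (hP : P ∈ fieldGr k) :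
    homotopy P ∈ fieldGr (k + -1) := by
  have h1 : onCoeff casimirInv P ∈ fieldGr k :=
    fieldGr_le (S := (fieldGr k).comap (onCoeff casimirInv))
      (fun _ x hx => tmul_mem_fieldGr _ hx) hP
  rw [homotopy, LinearMap.add_apply, Module.End.mul_apply, LinearMap.sum_apply]
  exact add_mem (sum_mem fun a _ => Submodule.smul_mem _ _ (onCoeff_mul_onExt_mem _ (isDeg_ctr a) h1))
    (onCoeff_mul_onExt_mem _ isDeg_cohom hP)

theorem sub_harmonic_mem_coboundaries {k : ℕ} {P : Multivector Coord ℝ}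
    (hP : P ∈ cocycles poisson k) : P - harmonic P ∈ coboundaries poisson k := by
  obtain ⟨h1, h2⟩ := hP
  have h3 : schouten poisson (homotopy P) = P - harmonic P := by
    have h := LinearMap.congr_fun schouten_homotopy P
    rw [LinearMap.add_apply, Module.End.mul_apply, Module.End.mul_apply,
      LinearMap.mem_ker.1 h2, map_zero, add_zero] at h
    exact h
  have h4 : homotopy P ∈ fieldGr (k + -1) := homotopy_mem (by rw [fieldGr_natCast]; exact h1)
  rw [← h3]
  cases k with
  | zero =>
    -- In degree 0 the homotopy lands in degree -1, which is zero, so a 0-cocycle equals its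
    -- harmonic part.
    rw [fieldGr_of_neg (by norm_num), Submodule.mem_bot] at h4
    rw [h4, map_zero]
    exact zero_mem _
  | succ k =>
    rw [show ((k + 1 : ℕ) : ℤ) + -1 = k by push_cast; ring, fieldGr_natCast] at h4
    exact ⟨_, h4, rfl⟩

theorem cls_harmonic {k : ℕ} {P : Multivector Coord ℝ} (hP : P ∈ cocycles poisson k) :
    cls poisson k (harmonic P) = cls poisson k P :=
  ((Submodule.Quotient.eq _).2 (sub_harmonic_mem_coboundaries hP)).symm

theorem harmonic_eq_of_cls_eq {k : ℕ} {P R : Multivector Coord ℝ}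
    (h : cls poisson k P = cls poisson k R) : harmonic P = harmonic R := by
  have h1 : P - R ∈ coboundaries poisson k := (Submodule.Quotient.eq _).1 h
  have h2 : ∃ S, schouten poisson S = P - R := by
    cases k with
    | zero => exact ⟨0, by rw [map_zero, (Submodule.mem_bot ℝ).1 h1]⟩
    | succ k => obtain ⟨S, -, hS⟩ := h1; exact ⟨S, hS⟩
  obtain ⟨S, hS⟩ := h2
  rw [← sub_eq_zero, ← map_sub, ← hS]
  exact LinearMap.congr_fun harmonic_mul_schouten S

theorem mem_cocycles_of_harmonic {k : ℕ} {P : Multivector Coord ℝ} (hk : P ∈ fieldGr k)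
    (hP : harmonic P = P) : P ∈ cocycles poisson k := by
  refine ⟨by rw [← fieldGr_natCast]; exact hk, LinearMap.mem_ker.2 ?_⟩
  rw [← hP]
  exact LinearMap.congr_fun schouten_mul_harmonic P

/-- The coefficient of a formal multivector field given by a functional. -/
def coeffFun (φ : Ext →ₗ[ℝ] ℝ) : Multivector Coord ℝ →ₗ[ℝ] MvPowerSeries Coord ℝ :=
  (TensorProduct.rid ℝ (MvPowerSeries Coord ℝ)).toLinearMap ∘ₗ
    LinearMap.lTensor (MvPowerSeries Coord ℝ) φ

theorem coeffFun_tmul (φ : Ext →ₗ[ℝ] ℝ) (f : MvPowerSeries Coord ℝ) (x : Ext) :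
    coeffFun φ (f ⊗ₜ[ℝ] x) = φ x • f := by
  rw [coeffFun, LinearMap.comp_apply, LinearMap.lTensor_tmul]
  exact TensorProduct.rid_tmul _ _

theorem coeffFun_eq_zero {φ : Ext →ₗ[ℝ] ℝ} {k : ℤ} (h : ∀ x ∈ gr k, φ x = 0)
    {P : Multivector Coord ℝ} (hP : P ∈ fieldGr k) : coeffFun φ P = 0 :=
  fieldGr_le (S := LinearMap.ker (coeffFun φ)) (fun f x hx => by
    rw [LinearMap.mem_ker, coeffFun_tmul, h x hx, zero_smul]) hP

theorem harmonic_apply (P : Multivector Coord ℝ) : harmonic P =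
    invProj (coeffFun vacFun P) ⊗ₜ[ℝ] 1 + invProj (coeffFun cRFun P) ⊗ₜ[ℝ] cR +
      invProj (coeffFun cIFun P) ⊗ₜ[ℝ] cI + invProj (coeffFun topFun P) ⊗ₜ[ℝ] (cR * cI) := by
  induction P using TensorProduct.induction_on with
  | zero => simp only [map_zero, TensorProduct.zero_tmul, add_zero]
  | tmul f x =>
    rw [harmonic, Module.End.mul_apply, onExt_tmul, onCoeff_tmul, harm_apply]
    simp only [coeffFun_tmul, map_smul, TensorProduct.tmul_add, TensorProduct.tmul_smul,
      TensorProduct.smul_tmul']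
  | add P R hP hR =>
    simp only [map_add, hP, hR, TensorProduct.add_tmul]
    abel

theorem harmonic_tmul {f : MvPowerSeries Coord ℝ} (hf : ∀ i, ham i f = 0) {x : Ext}
    (hx : harm x = x) : harmonic (f ⊗ₜ[ℝ] x) = f ⊗ₜ[ℝ] x := by
  rw [harmonic, Module.End.mul_apply, onExt_tmul, onCoeff_tmul, hx, invProj_apply_of_invariant hf]

theorem harm_one : harm 1 = 1 := by
  rw [harm_apply, vacFun_one, cRFun_eq_zero (by norm_num) one_mem_gr,
    cIFun_eq_zero (by norm_num) one_mem_gr, topFun_eq_zero (by norm_num) one_mem_gr]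
  simp only [one_smul, zero_smul, add_zero]

theorem harm_cR : harm cR = cR := by
  rw [harm_apply, vacFun_eq_zero (by norm_num) cR_mem_gr, cRFun_cR, cIFun_cR,
    topFun_eq_zero (by norm_num) cR_mem_gr]
  simp only [one_smul, zero_smul, add_zero, zero_add]

theorem harm_cI : harm cI = cI := by
  rw [harm_apply, vacFun_eq_zero (by norm_num) cI_mem_gr, cRFun_cI, cIFun_cI,
    topFun_eq_zero (by norm_num) cI_mem_gr]
  simp only [one_smul, zero_smul, add_zero, zero_add]

theorem harm_cR_mul_cI : harm (cR * cI) = cR * cI := by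
  rw [harm_apply, vacFun_eq_zero (by norm_num) cR_mul_cI_mem_gr,
    cRFun_eq_zero (by norm_num) cR_mul_cI_mem_gr, cIFun_eq_zero (by norm_num) cR_mul_cI_mem_gr,
    topFun_top]
  simp only [one_smul, zero_smul, zero_add]

theorem ham_invProj_apply (f : MvPowerSeries Coord ℝ) (i : Coord) : ham i (invProj f) = 0 :=
  LinearMap.congr_fun (ham_mul_invProj i) f

end SL2C
end

/-! ### Divisibility and the gradient of an invariant series -/

noncomputable section

namespace FormalPoisson

open MvPowerSeries

/-- Let g₀ be the part of g free of X_s. Then p g₀ is divisible by X_s but, like p, free of X_s, so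
it is zero; hence g₀ = 0 in a domain. -/
theorem X_dvd_of_X_dvd_mul {σ R : Type*} [CommRing R] [IsDomain R] {s : σ}
    {p g : MvPowerSeries σ R} (hp : p ≠ 0) (hp' : ∀ m : σ →₀ ℕ, m s ≠ 0 → coeff m p = 0)
    (h : X s ∣ p * g) : X s ∣ g := by
  classical
  let g₀ : MvPowerSeries σ R := fun m => if m s = 0 then coeff m g else 0
  have hg₀ (m : σ →₀ ℕ) : coeff m g₀ = if m s = 0 then coeff m g else 0 := rfl
  have h1 : X s ∣ g - g₀ := X_dvd_iff.2 fun m hm => by rw [map_sub, hg₀, if_pos hm, sub_self]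
  have h2 : X s ∣ p * g₀ := by
    have : p * g₀ = p * g - p * (g - g₀) := by ring
    rw [this]
    exact dvd_sub h (h1.mul_left p)
  have h3 : p * g₀ = 0 := by
    ext m
    rw [map_zero]
    by_cases hm : m s = 0
    · exact X_dvd_iff.1 h2 m hm
    · rw [coeff_mul]
      refine Finset.sum_eq_zero fun q hq => ?_
      by_cases hq1 : q.1 s = 0
      · rw [hg₀, if_neg, mul_zero]
        intro hq2
        rw [← Finset.HasAntidiagonal.mem_antidiagonal.1 hq, Finsupp.add_apply, hq1, hq2] at hm
        exact hm rfl
      · rw [hp' _ hq1, zero_mul]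
  have h4 : g₀ = 0 := (mul_eq_zero.1 h3).resolve_left hp
  rwa [h4, sub_zero] at h1

end FormalPoisson

namespace SL2C

open FormalPoisson ExteriorModel MvPowerSeries

/-- The substitution which replaces `x_c` by `x_c + r y_c`. -/
def shear (c : Fin 3) (r : ℂ) (s : Coord) : CSeries :=
  if s = .inl c then X (.inl c) + C r * X (.inr c) else X s

theorem hasSubst_shear (c : Fin 3) (r : ℂ) : HasSubst (shear c r) :=
  hasSubst_of_constantCoeff_zero fun s => by
    rw [shear]
    split_ifs <;> simp

theorem subst_C_mul_X {a : Coord → CSeries} (ha : HasSubst a) (r : ℂ) (s : Coord) :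
    subst a (C r * X s : CSeries) = C r * a s := by
  rw [← smul_eq_C_mul, subst_smul ha, subst_X ha, smul_eq_C_mul]

theorem subst_shear_shear (c : Fin 3) (r : ℂ) (f : CSeries) :
    subst (shear c r) (subst (shear c (-r)) f) = f := by
  rw [subst_comp_subst_apply (hasSubst_shear c _) (hasSubst_shear c _)]
  have h : (fun s => subst (shear c r) (shear c (-r) s)) = (X : Coord → CSeries) := by
    ext1 s
    have h0 : shear c r (.inr c) = X (.inr c) := if_neg (by simp)
    by_cases hs : s = .inl c
    · rw [hs, shear, if_pos rfl, subst_add (hasSubst_shear c _), subst_X (hasSubst_shear c _),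
        subst_C_mul_X (hasSubst_shear c _), h0, shear, if_pos rfl, map_neg]
      ring
    · rw [shear, if_neg hs, subst_X (hasSubst_shear c _), shear, if_neg hs]
  rw [h, subst_self]
  rfl

/-- The shear x_c ↦ x_c - i y_c is invertible, turns z_c into the variable x_c and fixes z_b, in
which x_c does not occur. This reduces the claim to divisibility by a variable. -/
theorem z_dvd_of_z_dvd_mul {b c : Fin 3} (hbc : b ≠ c) {g : CSeries} (h : z c ∣ z b * g) :
    z c ∣ g := by
  have hz (k : Fin 3) : z k = X (.inl k) + C Complex.I * X (.inr k) := rfl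
  have h0 (r : ℂ) (k : Fin 3) : shear c r (.inr k) = X (.inr k) := if_neg (by simp)
  have h1 : subst (shear c (-Complex.I)) (z c) = X (.inl c) := by
    rw [hz, subst_add (hasSubst_shear c _), subst_X (hasSubst_shear c _),
      subst_C_mul_X (hasSubst_shear c _), h0, shear, if_pos rfl, map_neg]
    ring
  have h2 : subst (shear c (-Complex.I)) (z b) = z b := by
    rw [hz, subst_add (hasSubst_shear c _), subst_X (hasSubst_shear c _),
      subst_C_mul_X (hasSubst_shear c _), h0, shear, if_neg (by simpa using hbc)]
  have h3 : subst (shear c Complex.I) (X (.inl c) : CSeries) = z c := by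
    rw [subst_X (hasSubst_shear c _), shear, if_pos rfl, hz]
  obtain ⟨q, hq⟩ := h
  have h4 : (X (.inl c) : CSeries) ∣ z b * subst (shear c (-Complex.I)) g := by
    refine ⟨subst (shear c (-Complex.I)) q, ?_⟩
    have := congrArg (subst (shear c (-Complex.I))) hq
    rwa [subst_mul (hasSubst_shear c _), subst_mul (hasSubst_shear c _), h1, h2] at this
  have hzc (m : Coord →₀ ℕ) : coeff m (z b) =
      (if m = Finsupp.single (.inl b) 1 then 1 else 0) +
        Complex.I * if m = Finsupp.single (.inr b) 1 then 1 else 0 := by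
    rw [hz, map_add, coeff_C_mul, coeff_X, coeff_X]
  have h5 : (X (.inl c) : CSeries) ∣ subst (shear c (-Complex.I)) g := by
    refine X_dvd_of_X_dvd_mul ?_ (fun m hm => ?_) h4
    · intro h
      have := hzc (Finsupp.single (.inl b) 1)
      rw [h, if_pos rfl, if_neg, mul_zero, map_zero, add_zero] at this
      · exact one_ne_zero this.symm
      · simp [Finsupp.single_left_inj]
    · rw [hzc, if_neg, if_neg, mul_zero, add_zero]
      · rintro rfl
        simp at hm
      · rintro rfl
        simp [hbc] at hm
  obtain ⟨u, hu⟩ := h5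
  refine ⟨subst (shear c Complex.I) u, ?_⟩
  have := congrArg (subst (shear c Complex.I)) hu
  rwa [subst_shear_shear, subst_mul (hasSubst_shear c _), h3] at this

/-- A real series as a complex series. -/
def ofReal : RSeries →+* CSeries := MvPowerSeries.map (algebraMap ℝ ℂ)

theorem reSeries_ofReal (f g : RSeries) :
    reSeries (ofReal f + const Complex.I * ofReal g) = f := by
  ext n
  change (coeff n (ofReal f + const Complex.I * ofReal g)).re = _
  rw [map_add, const, coeff_C_mul, ofReal, coeff_map, coeff_map]
  simp

theorem imSeries_ofReal (f g : RSeries) :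
    imSeries (ofReal f + const Complex.I * ofReal g) = g := by
  ext n
  change (coeff n (ofReal f + const Complex.I * ofReal g)).im = _
  rw [map_add, const, coeff_C_mul, ofReal, coeff_map, coeff_map]
  simp

theorem ofReal_re_im (F : CSeries) :
    F = ofReal (reSeries F) + const Complex.I * ofReal (imSeries F) := by
  ext n
  rw [map_add, const, coeff_C_mul, ofReal, coeff_map, coeff_map, mul_comm]
  exact (Complex.re_add_im _).symm

theorem const_I_mul_self : const Complex.I * const Complex.I = -1 := by
  simp only [const, ← map_mul, Complex.I_mul_I, map_neg, map_one]

theorem z_eq_ofReal (c : Fin 3) :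
    z c = ofReal (X (.inl c)) + const Complex.I * ofReal (X (.inr c)) := by
  rw [ofReal, map_X, map_X, z]

theorem realCasimirs_zero : realCasimirs 0 =
    ∑ b, ((X (.inl b) : RSeries) * X (.inl b) - X (.inr b) * X (.inr b)) := by
  refine Eq.trans ?_ (reSeries_ofReal _ (∑ b, ((X (.inl b) : RSeries) * X (.inr b) + X (.inl b) * X (.inr b))))
  refine congrArg reSeries ?_
  simp only [casimir_eq, z_eq_ofReal, Fin.sum_univ_three, map_add, map_sub, map_mul]
  linear_combination (ofReal (X (.inr 0)) ^ 2 + ofReal (X (.inr 1)) ^ 2 +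
    ofReal (X (.inr 2)) ^ 2) * const_I_mul_self

theorem realCasimirs_one : realCasimirs 1 =
    ∑ b, ((X (.inl b) : RSeries) * X (.inr b) + X (.inl b) * X (.inr b)) := by
  refine Eq.trans ?_ (imSeries_ofReal (∑ b, ((X (.inl b) : RSeries) * X (.inl b) - X (.inr b) * X (.inr b))) _)
  refine congrArg imSeries ?_
  simp only [casimir_eq, z_eq_ofReal, Fin.sum_univ_three, map_add, map_sub, map_mul]
  linear_combination (ofReal (X (.inr 0)) ^ 2 + ofReal (X (.inr 1)) ^ 2 +
    ofReal (X (.inr 2)) ^ 2) * const_I_mul_self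

theorem ham_apply (i : Coord) (f : MvPowerSeries Coord ℝ) :
    ham i f = ∑ m, ∑ k, (str i m k : ℝ) • (X k * pderiv ℝ m f) := by
  rw [ham, linearField]
  simp only [LinearMap.sum_apply, LinearMap.smul_apply, Module.End.mul_apply, mulX_apply,
    partialD_apply]

theorem ham_inl_apply (a : Fin 3) (f : MvPowerSeries Coord ℝ) : ham (.inl a) f =
    X (.inl (a + 2)) * pderiv ℝ (.inl (a + 1)) f + X (.inr (a + 2)) * pderiv ℝ (.inr (a + 1)) f -
      X (.inl (a + 1)) * pderiv ℝ (.inl (a + 2)) f -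
      X (.inr (a + 1)) * pderiv ℝ (.inr (a + 2)) f := by
  rw [ham_apply]
  fin_cases a <;> simp [Fintype.sum_sum_type, Fin.sum_univ_three, str, eps] <;> ring

theorem ham_inr_apply (a : Fin 3) (f : MvPowerSeries Coord ℝ) : ham (.inr a) f =
    X (.inr (a + 2)) * pderiv ℝ (.inl (a + 1)) f - X (.inl (a + 2)) * pderiv ℝ (.inr (a + 1)) f -
      X (.inr (a + 1)) * pderiv ℝ (.inl (a + 2)) f +
      X (.inl (a + 1)) * pderiv ℝ (.inr (a + 2)) f := by
  rw [ham_apply]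
  fin_cases a <;> simp [Fintype.sum_sum_type, Fin.sum_univ_three, str, eps] <;> ring

/-- The gradient of an invariant series is proportional to the position, over the complex numbers. -/
theorem exists_gradient {f : MvPowerSeries Coord ℝ} (hf : ∀ i, ham i f = 0) :
    ∃ F G : MvPowerSeries Coord ℝ, ∀ b : Fin 3,
      pderiv ℝ (.inl b) f = X (.inl b) * F - X (.inr b) * G ∧
      pderiv ℝ (.inr b) f = -(X (.inl b) * G) - X (.inr b) * F := by
  -- This is 2 ∂f/∂z_b.
  let D (b : Fin 3) : CSeries :=
    ofReal (pderiv ℝ (.inl b) f) + const Complex.I * ofReal (-pderiv ℝ (.inr b) f)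
  -- The equations for x_a and y_a are the real and imaginary parts of one component of z × ∂_z f =
  -- 0, up to terms with i² = -1.
  have hD (a : Fin 3) : z (a + 2) * D (a + 1) = z (a + 1) * D (a + 2) := by
    have h1 := congrArg ofReal ((ham_inl_apply a f).symm.trans (hf _))
    have h2 := congrArg ofReal ((ham_inr_apply a f).symm.trans (hf _))
    simp only [map_add, map_sub, map_mul, map_zero] at h1 h2
    simp only [D, z_eq_ofReal, map_neg]
    linear_combination h1 + const Complex.I * h2 +
      (-ofReal (X (.inr (a + 2))) * ofReal (pderiv ℝ (.inr (a + 1)) f) +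
        ofReal (X (.inr (a + 1))) * ofReal (pderiv ℝ (.inr (a + 2)) f)) * const_I_mul_self
  have h0 : z 2 * D 1 = z 1 * D 2 := hD 0
  have h1 : z 0 * D 2 = z 2 * D 0 := hD 1
  obtain ⟨F, hF⟩ : z 2 ∣ D 2 :=
    z_dvd_of_z_dvd_mul (b := 1) (by decide) ⟨D 1, h0.symm⟩
  have hz : z 2 ≠ 0 := by
    intro h
    have := congrArg reSeries h
    rw [z_eq_ofReal, reSeries_ofReal, map_zero] at this
    have h' := congrArg (coeff (Finsupp.single (.inl 2) 1)) this
    rw [coeff_index_single_self_X, map_zero] at h'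
    exact one_ne_zero h'
  have hDF (b : Fin 3) : D b = z b * F := by
    have h2 : D 1 = z 1 * F := mul_left_cancel₀ hz (by rw [h0, hF]; ring)
    have h3 : D 0 = z 0 * F := mul_left_cancel₀ hz (by rw [← h1, hF]; ring)
    fin_cases b
    · exact h3
    · exact h2
    · exact hF
  refine ⟨reSeries F, imSeries F, fun b => ?_⟩
  have h2 : D b = ofReal (X (.inl b) * reSeries F - X (.inr b) * imSeries F) +
      const Complex.I * ofReal (X (.inl b) * imSeries F + X (.inr b) * reSeries F) := by
    rw [hDF, z_eq_ofReal]
    conv_lhs => rw [ofReal_re_im F]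
    simp only [map_add, map_sub, map_mul]
    linear_combination (ofReal (X (.inr b)) * ofReal (imSeries F)) * const_I_mul_self
  constructor
  · have := congrArg reSeries h2
    rwa [reSeries_ofReal, reSeries_ofReal] at this
  · have := congrArg imSeries h2
    rw [imSeries_ofReal, imSeries_ofReal] at this
    rw [← neg_neg (pderiv ℝ (.inr b) f), this]
    ring

end SL2C
end

/-! ### Invariant series are power series in the Casimir functions -/

noncomputable section

namespace SL2C

open FormalPoisson ExteriorModel MvPowerSeries

theorem add_one_ne : ∀ a : Fin 3, a + 1 ≠ a ∧ a + 2 ≠ a := by decide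

/-- The fields of x_a and y_a involve only the coordinates and derivatives with indices a + 1 and a
+ 2. The same reason gives `ham_X_mul`. -/
theorem ham_pderiv {a : Fin 3} {i k : Coord} (hi : i = .inl a ∨ i = .inr a)
    (hk : k = .inl a ∨ k = .inr a) (f : MvPowerSeries Coord ℝ) :
    ham i (pderiv ℝ k f) = pderiv ℝ k (ham i f) := by
  obtain ⟨h1, h2⟩ := add_one_ne a
  have hX (s : Coord) (hs : s ≠ k) (g : MvPowerSeries Coord ℝ) :
      pderiv ℝ k (X s * g) = X s * pderiv ℝ k g := by
    rw [Derivation.leibniz, pderiv_X_of_ne hs, smul_zero, add_zero, smul_eq_mul]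
  have e1 : (.inl (a + 1) : Coord) ≠ k := by rcases hk with rfl | rfl <;> simp
  have e2 : (.inl (a + 2) : Coord) ≠ k := by rcases hk with rfl | rfl <;> simp [h2]
  have e3 : (.inr (a + 1) : Coord) ≠ k := by rcases hk with rfl | rfl <;> simp
  have e4 : (.inr (a + 2) : Coord) ≠ k := by rcases hk with rfl | rfl <;> simp [h2]
  rcases hi with rfl | rfl
  · simp only [ham_inl_apply, map_add, map_sub, hX _ e1, hX _ e2, hX _ e3, hX _ e4,
      pderiv_comm k]
  · simp only [ham_inr_apply, map_add, map_sub, hX _ e1, hX _ e2, hX _ e3, hX _ e4,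
      pderiv_comm k]

theorem ham_X_mul {a : Fin 3} {i k : Coord} (hi : i = .inl a ∨ i = .inr a)
    (hk : k = .inl a ∨ k = .inr a) (f : MvPowerSeries Coord ℝ) :
    ham i (X k * f) = X k * ham i f := by
  obtain ⟨h1, h2⟩ := add_one_ne a
  have hX (s : Coord) (hs : k ≠ s) : pderiv ℝ s (X k * f) = X k * pderiv ℝ s f := by
    rw [Derivation.leibniz, pderiv_X_of_ne hs, smul_zero, add_zero, smul_eq_mul]
  have e1 : k ≠ (.inl (a + 1) : Coord) := by rcases hk with rfl | rfl <;> simp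
  have e2 : k ≠ (.inl (a + 2) : Coord) := by rcases hk with rfl | rfl <;> simp [h2.symm]
  have e3 : k ≠ (.inr (a + 1) : Coord) := by rcases hk with rfl | rfl <;> simp
  have e4 : k ≠ (.inr (a + 2) : Coord) := by rcases hk with rfl | rfl <;> simp [h2.symm]
  rcases hi with rfl | rfl
  · simp only [ham_inl_apply, hX _ e1, hX _ e2, hX _ e3, hX _ e4]
    ring
  · simp only [ham_inr_apply, hX _ e1, hX _ e2, hX _ e3, hX _ e4]
    ring

theorem X_sq_add_X_sq_ne_zero {j k : Coord} (h : j ≠ k) :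
    (X j * X j + X k * X k : MvPowerSeries Coord ℝ) ≠ 0 := by
  intro h0
  have h1 := congrArg (coeff (Finsupp.single j 2)) h0
  rw [← pow_two, ← pow_two, map_add, coeff_X_pow, coeff_X_pow, if_pos rfl, if_neg, map_zero,
    add_zero] at h1
  · exact one_ne_zero h1
  · rw [Finsupp.single_left_inj two_ne_zero]
    exact h

/-- The coefficients of the gradient of an invariant series are invariant. -/
theorem ham_gradient {f F G : MvPowerSeries Coord ℝ} (hf : ∀ i, ham i f = 0)
    (h : ∀ b : Fin 3, pderiv ℝ (.inl b) f = X (.inl b) * F - X (.inr b) * G ∧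
      pderiv ℝ (.inr b) f = -(X (.inl b) * G) - X (.inr b) * F) (i : Coord) :
    ham i F = 0 ∧ ham i G = 0 := by
  obtain ⟨a, hi⟩ : ∃ a, i = .inl a ∨ i = .inr a := by
    rcases i with a | a
    · exact ⟨a, .inl rfl⟩
    · exact ⟨a, .inr rfl⟩
  have h1 := ham_pderiv hi (.inl rfl) f
  have h2 := ham_pderiv hi (.inr rfl) f
  rw [hf, map_zero, (h a).1, map_sub, ham_X_mul hi (.inl rfl), ham_X_mul hi (.inr rfl)] at h1
  rw [hf, map_zero, (h a).2, map_sub, map_neg, ham_X_mul hi (.inl rfl),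
    ham_X_mul hi (.inr rfl)] at h2
  -- The equations `h1` and `h2` are linear in `ham i F` and `ham i G`, with determinant x_a² + y_a²
  -- up to sign.
  have hne := X_sq_add_X_sq_ne_zero (j := .inl a) (k := .inr a) (by simp)
  constructor
  · refine (mul_eq_zero.1 (?_ : (X (.inl a) * X (.inl a) + X (.inr a) * X (.inr a)) *
      ham i F = 0)).resolve_left hne
    linear_combination X (.inl a) * h1 - X (.inr a) * h2
  · refine (mul_eq_zero.1 (?_ : (X (.inl a) * X (.inl a) + X (.inr a) * X (.inr a)) *
      ham i G = 0)).resolve_left hne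
    linear_combination -X (.inl a) * h2 - X (.inr a) * h1

theorem coeff_X_mul_pderiv (α : Coord →₀ ℕ) (k : Coord) (f : MvPowerSeries Coord ℝ) :
    coeff α (X k * pderiv ℝ k f) = α k * coeff α f := by
  rw [X, coeff_monomial_mul]
  split_ifs with hle
  · rw [coeff_pderiv, tsub_add_cancel_of_le hle, one_mul, mul_comm]
    congr 1
    rw [Finsupp.tsub_apply, Finsupp.single_eq_same]
    have : 1 ≤ α k := by simpa using hle k
    push_cast [this]
    ring
  · have : α k = 0 := by
      by_contra hk
      refine hle fun s => ?_
      rw [Finsupp.single_apply]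
      split_ifs with hs
      · subst hs; omega
      · exact Nat.zero_le _
    rw [this, Nat.cast_zero, zero_mul]

theorem coeff_euler (α : Coord →₀ ℕ) (f : MvPowerSeries Coord ℝ) :
    coeff α (∑ k, X k * pderiv ℝ k f) = α.degree * coeff α f := by
  rw [map_sum, Finsupp.degree_eq_sum, Nat.cast_sum, Finset.sum_mul]
  exact Finset.sum_congr rfl fun k _ => coeff_X_mul_pderiv α k f

/-- The Casimir functions as polynomials. -/
def casPoly : Fin 2 → MvPolynomial Coord ℝ :=
  ![∑ b, (MvPolynomial.X (.inl b) * MvPolynomial.X (.inl b) -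
      MvPolynomial.X (.inr b) * MvPolynomial.X (.inr b)),
    ∑ b, (MvPolynomial.X (.inl b) * MvPolynomial.X (.inr b) +
      MvPolynomial.X (.inl b) * MvPolynomial.X (.inr b))]

theorem casPoly_zero : casPoly 0 =
    ∑ b, (MvPolynomial.X (.inl b) * MvPolynomial.X (.inl b) -
      MvPolynomial.X (.inr b) * MvPolynomial.X (.inr b)) := rfl

theorem casPoly_one : casPoly 1 =
    ∑ b, (MvPolynomial.X (.inl b) * MvPolynomial.X (.inr b) +
      MvPolynomial.X (.inl b) * MvPolynomial.X (.inr b)) := rfl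

theorem casPoly_coe (s : Fin 2) : (casPoly s : MvPowerSeries Coord ℝ) = realCasimirs s := by
  change MvPolynomial.coeToMvPowerSeries.ringHom (casPoly s) = _
  have hX (k : Coord) : MvPolynomial.coeToMvPowerSeries.ringHom (MvPolynomial.X k) =
      (X k : MvPowerSeries Coord ℝ) := MvPolynomial.coe_X k
  match s with
  | 0 => rw [casPoly_zero, realCasimirs_zero]; simp only [map_sum, map_sub, map_mul, hX]
  | 1 => rw [casPoly_one, realCasimirs_one]; simp only [map_sum, map_add, map_mul, hX]

theorem casPoly_isHomogeneous (s : Fin 2) : (casPoly s).IsHomogeneous 2 := by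
  have h (j k : Coord) : (MvPolynomial.X j * MvPolynomial.X k : MvPolynomial Coord ℝ).IsHomogeneous 2 :=
    (MvPolynomial.isHomogeneous_X _ _).mul (MvPolynomial.isHomogeneous_X _ _)
  match s with
  | 0 =>
    rw [casPoly_zero]
    exact MvPolynomial.IsHomogeneous.sum _ _ _ fun b _ => (h _ _).sub (h _ _)
  | 1 =>
    rw [casPoly_one]
    exact MvPolynomial.IsHomogeneous.sum _ _ _ fun b _ => (h _ _).add (h _ _)

/-- The monomials in the Casimir functions. -/
def casMon (β : Fin 2 →₀ ℕ) : MvPowerSeries Coord ℝ := β.prod fun s e => realCasimirs s ^ e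

theorem casMon_eq_coe (β : Fin 2 →₀ ℕ) :
    casMon β = ((β.prod fun s e => casPoly s ^ e : MvPolynomial Coord ℝ) : MvPowerSeries Coord ℝ) := by
  change _ = MvPolynomial.coeToMvPowerSeries.ringHom (β.prod fun s e => casPoly s ^ e)
  rw [casMon, Finsupp.prod, Finsupp.prod, map_prod]
  refine Finset.prod_congr rfl fun s _ => ?_
  rw [map_pow, ← casPoly_coe]
  rfl

theorem coeff_casMon_of_ne {β : Fin 2 →₀ ℕ} {α : Coord →₀ ℕ} (h : 2 * β.degree ≠ α.degree) :
    coeff α (casMon β) = 0 := by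
  rw [casMon_eq_coe, MvPolynomial.coeff_coe]
  refine MvPolynomial.IsHomogeneous.coeff_eq_zero (n := 2 * β.degree) ?_ h.symm
  rw [Finsupp.degree_eq_sum, Finset.mul_sum, Finsupp.prod_fintype _ _ fun _ => pow_zero _]
  exact MvPolynomial.IsHomogeneous.prod _ _ _ fun s _ => (casPoly_isHomogeneous s).pow _

theorem realCasimirs_mul_mem_vanishing (s : Fin 2) {n : ℕ} {f : MvPowerSeries Coord ℝ}
    (hf : ∀ m, m + 2 = n → f ∈ vanishing Coord m) : realCasimirs s * f ∈ vanishing Coord n := by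
  classical
  intro α hα
  rw [coeff_mul]
  refine Finset.sum_eq_zero fun p hp => ?_
  by_cases h : p.1.degree = 2
  · have h' := congrArg Finsupp.degree (Finset.HasAntidiagonal.mem_antidiagonal.1 hp)
    rw [map_add, hα, h, add_comm] at h'
    rw [hf _ h' p.2 rfl, mul_zero]
  · rw [← casPoly_coe, MvPolynomial.coeff_coe, (casPoly_isHomogeneous s).coeff_eq_zero h, zero_mul]

/-- The homogeneous polynomials in the Casimir functions. -/
def casSpan (n : ℕ) : Submodule ℝ (MvPowerSeries Coord ℝ) :=
  Submodule.span ℝ (casMon '' {β | 2 * β.degree = n})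

theorem casMon_single_add (s : Fin 2) (β : Fin 2 →₀ ℕ) :
    casMon (Finsupp.single s 1 + β) = realCasimirs s * casMon β := by
  rw [casMon, Finsupp.prod_add_index' (fun _ => pow_zero _) (fun _ => pow_add _),
    casMon]
  congr 1
  exact (Finsupp.prod_single_index (h := fun x e => realCasimirs x ^ e)
    (pow_zero (realCasimirs s))).trans (pow_one (realCasimirs s))

theorem realCasimirs_mul_mem_casSpan (s : Fin 2) {n : ℕ} {w : MvPowerSeries Coord ℝ}
    (hw : w ∈ casSpan n) : realCasimirs s * w ∈ casSpan (n + 2) := by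
  have h : casSpan n ≤ (casSpan (n + 2)).comap (LinearMap.mulLeft ℝ (realCasimirs s)) := by
    refine Submodule.span_le.2 ?_
    rintro _ ⟨β, hβ, rfl⟩
    refine Submodule.subset_span ⟨Finsupp.single s 1 + β, ?_, casMon_single_add s β⟩
    rw [Set.mem_ofPred_eq] at hβ ⊢
    rw [map_add, Finsupp.degree_single]
    omega
  exact h hw

/-- Both sides are the real part of (f₁ + i f₂)(F + iG). The factors f₁, f₂ have degree 2, so only
lower components of F and G matter. -/
theorem euler_eq {f F G : MvPowerSeries Coord ℝ}
    (h : ∀ b : Fin 3, pderiv ℝ (.inl b) f = X (.inl b) * F - X (.inr b) * G ∧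
      pderiv ℝ (.inr b) f = -(X (.inl b) * G) - X (.inr b) * F) :
    ∑ k, X k * pderiv ℝ k f = realCasimirs 0 * F - realCasimirs 1 * G := by
  rw [Fintype.sum_sum_type, realCasimirs_zero, realCasimirs_one]
  simp only [(h _).1, (h _).2, Fin.sum_univ_three]
  ring

/-- Strong induction on `n`: in degree `n` the Euler operator is multiplication by `n`, and the
gradient coefficients F, G are invariants to which the case `n - 2` applies. -/
theorem mem_casSpan_sup_vanishing (n : ℕ) : ∀ {f : MvPowerSeries Coord ℝ} (_ : ∀ i, ham i f = 0),
    f ∈ casSpan n ⊔ vanishing Coord n := by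
  induction n using Nat.strong_induction_on with
  | _ n ih =>
  intro f hf
  rcases Nat.eq_zero_or_pos n with rfl | hn
  · rw [Submodule.mem_sup]
    refine ⟨coeff 0 f • casMon 0, Submodule.smul_mem _ _ (Submodule.subset_span ⟨0, by simp, rfl⟩),
      f - coeff 0 f • casMon 0, fun α hα => ?_, by abel⟩
    rw [Finsupp.degree_eq_zero_iff] at hα
    rw [hα, map_sub, map_smul, casMon, Finsupp.prod_zero_index]
    simp
  · obtain ⟨F, G, h⟩ := exists_gradient hf
    have hmul (s : Fin 2) {w : MvPowerSeries Coord ℝ} (hw : ∀ i, ham i w = 0) :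
        realCasimirs s * w ∈ casSpan n ⊔ vanishing Coord n := by
      by_cases h2 : 2 ≤ n
      · obtain ⟨m, rfl⟩ := Nat.exists_eq_add_of_le' h2
        obtain ⟨u, hu, v, hv, rfl⟩ := Submodule.mem_sup.1 (ih m (by omega) hw)
        rw [mul_add]
        exact add_mem (Submodule.mem_sup_left (realCasimirs_mul_mem_casSpan s hu))
          (Submodule.mem_sup_right (realCasimirs_mul_mem_vanishing s fun k hk => by
            rwa [Nat.add_right_cancel hk]))
      -- For `n = 1` a product with a quadratic form has no component of degree `n`.
      · exact Submodule.mem_sup_right (realCasimirs_mul_mem_vanishing s fun k hk => by omega)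
    have h1 : (n : ℝ) • f - ∑ k, X k * pderiv ℝ k f ∈ vanishing Coord n := fun α hα => by
      rw [map_sub, coeff_euler, map_smul, hα, smul_eq_mul, sub_self]
    have h2 : (n : ℝ) • f ∈ casSpan n ⊔ vanishing Coord n := by
      have := add_mem (Submodule.mem_sup_right h1 : _ ∈ casSpan n ⊔ vanishing Coord n)
        (sub_mem (hmul 0 fun i => (ham_gradient hf h i).1)
          (hmul 1 fun i => (ham_gradient hf h i).2))
      rwa [← euler_eq h, sub_add_cancel] at this
    exact ((casSpan n ⊔ vanishing Coord n).smul_mem_iff (by exact_mod_cast hn.ne')).1 h2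

theorem coeff_evalCasimirs (g : MvPowerSeries (Fin 2) ℝ) (α : Coord →₀ ℕ) :
    coeff α (evalCasimirs g) =
      ∑ β ∈ exponents (Fin 2) (α.degree / 2), coeff β g * coeff α (casMon β) := by
  rw [evalCasimirs, coeff_subst hasSubst_realCasimirs]
  -- Only β with 2|β| equal to the degree of α contribute. In odd degree the rounded exponent set is
  -- harmless, since all its terms vanish.
  refine finsum_eq_sum_of_support_subset _ fun β hβ => ?_
  rw [Finset.mem_coe, mem_exponents]
  by_contra h
  refine hβ ?_
  change _ • coeff α (casMon β) = 0
  rw [coeff_casMon_of_ne (by omega), smul_zero]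

theorem exists_evalCasimirs {f : MvPowerSeries Coord ℝ} (hf : ∀ i, ham i f = 0) :
    ∃ g, evalCasimirs g = f := by
  have h (n : ℕ) : ∃ c : (Fin 2 →₀ ℕ) → ℝ,
      f - ∑ β ∈ exponents (Fin 2) (n / 2), c β • casMon β ∈ vanishing Coord n := by
    obtain ⟨u, hu, v, hv, rfl⟩ := Submodule.mem_sup.1 (mem_casSpan_sup_vanishing n hf)
    have hu' : u ∈ Submodule.span ℝ (casMon '' (exponents (Fin 2) (n / 2) : Set (Fin 2 →₀ ℕ))) := by
      refine Submodule.span_mono (Set.image_mono fun β hβ => ?_) hu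
      rw [Finset.mem_coe, mem_exponents]
      rw [Set.mem_ofPred_eq] at hβ
      omega
    obtain ⟨c, hc⟩ := (Submodule.mem_span_image_finset_iff_exists_fun' ℝ).1 hu'
    exact ⟨c, by rw [hc, add_sub_cancel_left]; exact hv⟩
  choose c hc using h
  -- The coefficient at β is taken from the homogeneous component of degree 2|β|, the only one in
  -- which this monomial appears.
  let g : MvPowerSeries (Fin 2) ℝ := fun β => c (2 * β.degree) β
  refine ⟨g, ?_⟩
  ext α
  have h1 := hc α.degree α rfl
  rw [map_sub, sub_eq_zero, map_sum] at h1
  rw [h1, coeff_evalCasimirs]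
  refine Finset.sum_congr rfl fun β _ => ?_
  rw [map_smul, smul_eq_mul]
  by_cases hβ : 2 * β.degree = α.degree
  · change c (2 * β.degree) β * _ = _
    rw [hβ]
  · rw [coeff_casMon_of_ne hβ, mul_zero, mul_zero]

/-- Every point of ℝ² is a value of (f₁, f₂): at z = (w, 0, 0) the value is w², and w can be any
complex square root. So p vanishes at all points. -/
theorem eq_zero_of_aeval_casPoly {p : MvPolynomial (Fin 2) ℝ}
    (hp : MvPolynomial.aeval casPoly p = 0) : p = 0 := by
  refine MvPolynomial.funext fun x => ?_
  obtain ⟨w, hw⟩ := IsAlgClosed.exists_eq_mul_self (⟨x 0, x 1⟩ : ℂ)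
  let v : Coord → ℝ := Sum.elim ![w.re, 0, 0] ![w.im, 0, 0]
  have hv : (fun s => MvPolynomial.aeval v (casPoly s)) = x := by
    have h0 : x 0 = w.re * w.re - w.im * w.im := by
      simpa using congrArg Complex.re hw
    have h1 : x 1 = w.re * w.im + w.im * w.re := by
      simpa using congrArg Complex.im hw
    ext s
    fin_cases s
    · simp [casPoly, v, Fin.sum_univ_three, h0]
    · simp [casPoly, v, Fin.sum_univ_three, h1, mul_comm]
  have h := congrArg (MvPolynomial.aeval v) hp
  rw [map_zero] at h
  have h' := (MvPolynomial.comp_aeval_apply casPoly (MvPolynomial.aeval v) p).symm.trans h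
  rw [hv] at h'
  rw [map_zero]
  exact h'

/-- Distinct degrees in two variables go to distinct degrees in six, so each homogeneous component
of the difference is a polynomial relation between f₁ and f₂, hence zero. -/
theorem evalCasimirs_injective : Function.Injective evalCasimirs := by
  intro g g' h
  ext β
  let p : MvPolynomial (Fin 2) ℝ := ∑ γ ∈ exponents (Fin 2) β.degree,
    MvPolynomial.monomial γ (coeff γ g - coeff γ g')
  have h1 : ((MvPolynomial.aeval casPoly p : MvPolynomial Coord ℝ) : MvPowerSeries Coord ℝ) =
      ∑ γ ∈ exponents (Fin 2) β.degree, (coeff γ g - coeff γ g') • casMon γ := by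
    change MvPolynomial.coeToMvPowerSeries.ringHom _ = _
    rw [map_sum, map_sum]
    refine Finset.sum_congr rfl fun γ _ => ?_
    rw [MvPolynomial.aeval_monomial, ← Algebra.smul_def, casMon_eq_coe]
    exact MvPolynomial.coe_smul _ _
  have h2 : MvPolynomial.aeval casPoly p = 0 := by
    refine MvPolynomial.coe_injective _ _ ?_
    rw [h1]
    ext α
    rw [map_sum]
    by_cases hα : α.degree = 2 * β.degree
    · have h3 := congrArg (coeff α) h
      rw [coeff_evalCasimirs, coeff_evalCasimirs, hα, Nat.mul_div_cancel_left _ two_pos,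
        ← sub_eq_zero, ← Finset.sum_sub_distrib] at h3
      simp only [map_smul, smul_eq_mul, sub_mul]
      simpa using h3
    · rw [Finset.sum_eq_zero fun γ hγ => ?_]
      · simp
      · rw [mem_exponents] at hγ
        rw [map_smul, coeff_casMon_of_ne (by rw [hγ]; exact Ne.symm hα), smul_zero]
  have h3 : MvPolynomial.coeff β p = coeff β g - coeff β g' := by
    rw [MvPolynomial.coeff_sum, Finset.sum_eq_single β]
    · rw [MvPolynomial.coeff_monomial, if_pos rfl]
    · intro γ _ hγ
      rw [MvPolynomial.coeff_monomial, if_neg hγ]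
    · intro hβ
      exact absurd (mem_exponents.2 rfl) hβ
  rw [eq_zero_of_aeval_casPoly h2, MvPolynomial.coeff_zero] at h3
  exact (sub_eq_zero.1 h3.symm)

theorem ham_mul (i : Coord) (f g : MvPowerSeries Coord ℝ) :
    ham i (f * g) = f * ham i g + g * ham i f := by
  simp only [ham_apply, Derivation.leibniz, smul_eq_mul, Finset.mul_sum, mul_smul_comm,
    ← Finset.sum_add_distrib, ← smul_add]
  refine Finset.sum_congr rfl fun m _ => Finset.sum_congr rfl fun k _ => ?_
  congr 1
  ring

/-- The algebra of invariant series. -/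
def invariants : Subalgebra ℝ (MvPowerSeries Coord ℝ) where
  carrier := {f | ∀ i, ham i f = 0}
  mul_mem' hf hg i := by rw [ham_mul, hf i, hg i, mul_zero, mul_zero, add_zero]
  add_mem' hf hg i := by rw [map_add, hf i, hg i, add_zero]
  algebraMap_mem' r i := by
    rw [ham_apply]
    refine Finset.sum_eq_zero fun m _ => Finset.sum_eq_zero fun k _ => ?_
    rw [Derivation.map_algebraMap, mul_zero, smul_zero]

theorem mem_invariants {f : MvPowerSeries Coord ℝ} : f ∈ invariants ↔ ∀ i, ham i f = 0 := Iff.rfl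

theorem realCasimirs_mem_invariants (s : Fin 2) : realCasimirs s ∈ invariants := by
  classical
  have hX (i j : Coord) : pderiv ℝ i (X j : MvPowerSeries Coord ℝ) = if i = j then 1 else 0 := by
    split_ifs with h
    · rw [h, pderiv_X_self]
    · exact pderiv_X_of_ne (Ne.symm h)
  intro i
  fin_cases s
  · refine (congrArg (ham i) realCasimirs_zero).trans ?_
    rcases i with a | a <;> fin_cases a <;>
      simp [Fin.sum_univ_three, ham_inl_apply, ham_inr_apply, hX] <;> ring
  · refine (congrArg (ham i) realCasimirs_one).trans ?_
    rcases i with a | a <;> fin_cases a <;>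
      simp [Fin.sum_univ_three, ham_inl_apply, ham_inr_apply, hX] <;> ring

/-- In each degree the series agrees with a polynomial in f₁, f₂, which is invariant, and the
hamiltonian fields preserve degrees. -/
theorem ham_evalCasimirs (g : MvPowerSeries (Fin 2) ℝ) (i : Coord) : ham i (evalCasimirs g) = 0 := by
  refine eq_zero_of_forall_mem_vanishing fun n => ?_
  have h1 : evalCasimirs g - ∑ β ∈ exponents (Fin 2) (n / 2), coeff β g • casMon β ∈
      vanishing Coord n := fun α hα => by
    rw [map_sub, coeff_evalCasimirs, hα, map_sum]
    simp only [map_smul, smul_eq_mul, sub_self]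
  have h2 : ∑ β ∈ exponents (Fin 2) (n / 2), coeff β g • casMon β ∈ invariants :=
    sum_mem fun β _ => Subalgebra.smul_mem _ (prod_mem fun s _ =>
      pow_mem (realCasimirs_mem_invariants s) _) _
  have h3 := preservesDegree_ham i n _ h1
  rwa [map_sub, mem_invariants.1 h2, sub_zero] at h3

end SL2C
end

/-! ### Computation of the cohomology -/

noncomputable section

namespace SL2C

open FormalPoisson

theorem smul_one_eq (f : RSeries) : f • (1 : Multivector Coord ℝ) = f ⊗ₜ[ℝ] (1 : Ext) := by
  rw [Algebra.TensorProduct.one_def, TensorProduct.smul_tmul', smul_eq_mul, mul_one]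

theorem smul_CR (f : RSeries) : f • CR = f ⊗ₜ[ℝ] cR := by
  rw [CR_eq, TensorProduct.smul_tmul', smul_eq_mul, mul_one]

theorem smul_CI (f : RSeries) : f • CI = f ⊗ₜ[ℝ] cI := by
  rw [CI_eq, TensorProduct.smul_tmul', smul_eq_mul, mul_one]

theorem smul_CR_mul_CI (f : RSeries) : f • (CR * CI) = f ⊗ₜ[ℝ] (cR * cI) := by
  rw [CR_eq, CI_eq, Algebra.TensorProduct.tmul_mul_tmul, mul_one, TensorProduct.smul_tmul',
    smul_eq_mul, mul_one]

/-- A map to harmonic fields which is injective and hits the harmonic part of every cocycle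
induces a bijection onto cohomology. -/
theorem bijOn_cohomology {Γ : Type*} {k : ℕ} {Ψ : Γ → Multivector Coord ℝ}
    (hk : ∀ g, Ψ g ∈ fieldGr k) (hΨ : ∀ g, harmonic (Ψ g) = Ψ g) (hinj : Function.Injective Ψ)
    (hsurj : ∀ P ∈ fieldGr k, ∃ g, Ψ g = harmonic P) :
    Set.BijOn (fun g => cls poisson k (Ψ g)) Set.univ (cohomology poisson k) := by
  refine ⟨fun g _ => ⟨Ψ g, mem_cocycles_of_harmonic (hk g) (hΨ g), rfl⟩, fun g _ g' _ h => ?_, ?_⟩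
  · have := harmonic_eq_of_cls_eq h
    rw [hΨ, hΨ] at this
    exact hinj this
  · rintro _ ⟨P, hP, rfl⟩
    obtain ⟨g, hg⟩ := hsurj P (by rw [fieldGr_natCast]; exact hP.1)
    exact ⟨g, Set.mem_univ _, by simp only [hg]; exact cls_harmonic hP⟩

theorem coeffFun_vacFun_eq_zero {k : ℕ} (hk : k ≠ 0) {P : Multivector Coord ℝ}
    (hP : P ∈ fieldGr k) : coeffFun vacFun P = 0 :=
  coeffFun_eq_zero (fun _ hx => vacFun_eq_zero (by exact_mod_cast hk) hx) hP

theorem coeffFun_cRFun_eq_zero {k : ℕ} (hk : k ≠ 3) {P : Multivector Coord ℝ}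
    (hP : P ∈ fieldGr k) : coeffFun cRFun P = 0 :=
  coeffFun_eq_zero (fun _ hx => cRFun_eq_zero (by exact_mod_cast hk) hx) hP

theorem coeffFun_cIFun_eq_zero {k : ℕ} (hk : k ≠ 3) {P : Multivector Coord ℝ}
    (hP : P ∈ fieldGr k) : coeffFun cIFun P = 0 :=
  coeffFun_eq_zero (fun _ hx => cIFun_eq_zero (by exact_mod_cast hk) hx) hP

theorem coeffFun_topFun_eq_zero {k : ℕ} (hk : k ≠ 6) {P : Multivector Coord ℝ}
    (hP : P ∈ fieldGr k) : coeffFun topFun P = 0 :=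
  coeffFun_eq_zero (fun _ hx => topFun_eq_zero (by exact_mod_cast hk) hx) hP

theorem exists_evalCasimirs_invProj (f : MvPowerSeries Coord ℝ) :
    ∃ g, evalCasimirs g = invProj f :=
  exists_evalCasimirs fun i => ham_invProj_apply f i

theorem bijOn_cohomology_zero :
    Set.BijOn (fun g : MvPowerSeries (Fin 2) ℝ =>
        cls poisson 0 (evalCasimirs g • (1 : Multivector Coord ℝ)))
      Set.univ (cohomology poisson 0) := by
  refine bijOn_cohomology (fun g => ?_) (fun g => ?_) (fun g g' h => ?_) (fun P hP => ?_)
  · rw [smul_one_eq]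
    exact tmul_mem_fieldGr _ one_mem_gr
  · rw [smul_one_eq]
    exact harmonic_tmul (ham_evalCasimirs g) harm_one
  · simp only [smul_one_eq] at h
    have := congrArg (coeffFun vacFun) h
    rw [coeffFun_tmul, coeffFun_tmul, vacFun_one, one_smul, one_smul] at this
    exact evalCasimirs_injective this
  · obtain ⟨g, hg⟩ := exists_evalCasimirs_invProj (coeffFun vacFun P)
    refine ⟨g, ?_⟩
    rw [smul_one_eq, hg, harmonic_apply, coeffFun_cRFun_eq_zero (by norm_num) hP,
      coeffFun_cIFun_eq_zero (by norm_num) hP, coeffFun_topFun_eq_zero (by norm_num) hP]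
    simp only [map_zero, TensorProduct.zero_tmul, add_zero]

theorem bijOn_cohomology_three :
    Set.BijOn (fun p : MvPowerSeries (Fin 2) ℝ × MvPowerSeries (Fin 2) ℝ =>
        cls poisson 3 (evalCasimirs p.1 • CR + evalCasimirs p.2 • CI))
      Set.univ (cohomology poisson 3) := by
  refine bijOn_cohomology (fun p => ?_) (fun p => ?_) (fun p p' h => ?_) (fun P hP => ?_)
  · rw [smul_CR, smul_CI]
    exact add_mem (tmul_mem_fieldGr _ cR_mem_gr) (tmul_mem_fieldGr _ cI_mem_gr)
  · rw [smul_CR, smul_CI, map_add, harmonic_tmul (ham_evalCasimirs _) harm_cR,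
      harmonic_tmul (ham_evalCasimirs _) harm_cI]
  · simp only [smul_CR, smul_CI] at h
    have h1 := congrArg (coeffFun cRFun) h
    have h2 := congrArg (coeffFun cIFun) h
    simp only [map_add, coeffFun_tmul, cRFun_cR, cRFun_cI, cIFun_cR, cIFun_cI, one_smul, zero_smul,
      add_zero, zero_add] at h1 h2
    exact Prod.ext (evalCasimirs_injective h1) (evalCasimirs_injective h2)
  · obtain ⟨g, hg⟩ := exists_evalCasimirs_invProj (coeffFun cRFun P)
    obtain ⟨g', hg'⟩ := exists_evalCasimirs_invProj (coeffFun cIFun P)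
    refine ⟨(g, g'), ?_⟩
    rw [smul_CR, smul_CI, hg, hg', harmonic_apply, coeffFun_vacFun_eq_zero (by norm_num) hP,
      coeffFun_topFun_eq_zero (by norm_num) hP]
    simp only [map_zero, TensorProduct.zero_tmul, add_zero, zero_add]

theorem bijOn_cohomology_six :
    Set.BijOn (fun g : MvPowerSeries (Fin 2) ℝ =>
        cls poisson 6 (evalCasimirs g • (CR * CI)))
      Set.univ (cohomology poisson 6) := by
  refine bijOn_cohomology (fun g => ?_) (fun g => ?_) (fun g g' h => ?_) (fun P hP => ?_)
  · rw [smul_CR_mul_CI]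
    exact tmul_mem_fieldGr _ cR_mul_cI_mem_gr
  · rw [smul_CR_mul_CI]
    exact harmonic_tmul (ham_evalCasimirs g) harm_cR_mul_cI
  · simp only [smul_CR_mul_CI] at h
    have := congrArg (coeffFun topFun) h
    rw [coeffFun_tmul, coeffFun_tmul, topFun_top, one_smul, one_smul] at this
    exact evalCasimirs_injective this
  · obtain ⟨g, hg⟩ := exists_evalCasimirs_invProj (coeffFun topFun P)
    refine ⟨g, ?_⟩
    rw [smul_CR_mul_CI, hg, harmonic_apply, coeffFun_vacFun_eq_zero (by norm_num) hP,
      coeffFun_cRFun_eq_zero (by norm_num) hP, coeffFun_cIFun_eq_zero (by norm_num) hP]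
    simp only [map_zero, TensorProduct.zero_tmul, zero_add]

theorem cohomology_eq_bot {k : ℕ} (h0 : k ≠ 0) (h3 : k ≠ 3) (h6 : k ≠ 6) :
    cohomology poisson k = ⊥ := by
  rw [eq_bot_iff]
  rintro _ ⟨P, hP, rfl⟩
  have hk : P ∈ fieldGr k := by rw [fieldGr_natCast]; exact hP.1
  rw [Submodule.mem_bot, ← cls_harmonic hP, harmonic_apply, coeffFun_vacFun_eq_zero h0 hk,
    coeffFun_cRFun_eq_zero h3 hk, coeffFun_cIFun_eq_zero h3 hk, coeffFun_topFun_eq_zero h6 hk]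
  simp only [map_zero, TensorProduct.zero_tmul, add_zero]

end SL2C
end

open FormalPoisson SL2C in
theorem proposition1p4 :
    -- degree 0: `g ↦ [g(f₁, f₂)]` is a bijection of `ℝ⟦f₁, f₂⟧` onto the cohomology
    Set.BijOn (fun g : MvPowerSeries (Fin 2) ℝ =>
        cls poisson 0 (evalCasimirs g • (1 : Multivector Coord ℝ)))
      Set.univ (cohomology poisson 0) ∧
    -- degree 3: the free `ℝ⟦f₁, f₂⟧`-module on the classes of `C_R` and `C_I`
    Set.BijOn (fun p : MvPowerSeries (Fin 2) ℝ × MvPowerSeries (Fin 2) ℝ =>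
        cls poisson 3 (evalCasimirs p.1 • CR + evalCasimirs p.2 • CI))
      Set.univ (cohomology poisson 3) ∧
    -- degree 6: the free `ℝ⟦f₁, f₂⟧`-module on the class of `C_R ∧ C_I`
    Set.BijOn (fun g : MvPowerSeries (Fin 2) ℝ =>
        cls poisson 6 (evalCasimirs g • (CR * CI)))
      Set.univ (cohomology poisson 6) ∧
    -- all other degrees
    (∀ k : ℕ, k ≠ 0 → k ≠ 3 → k ≠ 6 → cohomology poisson k = ⊥) ∧
    -- the explicit formulas
    CR = (1 / 2 : ℝ) • (dx 0 * dx 1 * dx 2 - dy 0 * dy 1 * dx 2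
      - dx 0 * dy 1 * dy 2 - dy 0 * dx 1 * dy 2) ∧
    CI = (1 / 2 : ℝ) • (dy 0 * dy 1 * dy 2 - dy 0 * dx 1 * dx 2
      - dx 0 * dy 1 * dx 2 - dx 0 * dx 1 * dy 2) :=
  ⟨bijOn_cohomology_zero, bijOn_cohomology_three, bijOn_cohomology_six,
    fun _ h0 h3 h6 => cohomology_eq_bot h0 h3 h6, CR_explicit, CI_explicit⟩
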